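/- Let $k>0$, $l>0$, and let $H_\nu^{(1,2)}=J_\nu\pm iY_\nu$ (principal branch); throughout, upper signs belong to $H^{(1)}$ and lower signs to $H^{(2)}$, and the superscript is omitted. Write $\dot H_1=\frac{d}{dz}H_1$, $p_1(x)=1-\frac xl$, $p_2(x)=\frac xl$, and, for $i,j\in\{1,2\}$, $$I_{ij}=\frac i4\int_0^l dx\int_{-x}^{l-x}dx'\,H_0(k|x'|)\,p_i(x)\,p_j(x+x').$$ *Kernel.* Let $g(\mathbf r,\mathbf r')=\frac i4H_0(k|\mathbf r-\mathbf r'|)$ on $\mathbb R^2$. If $\mathbf r$ and $\mathbf r'$ are points with abscissae $x$ and $x+x'$, $x'\neq0$, on a straight line with unit normal $\mathbf n=\mathbf n'$, then $$\frac{\partial^2g}{\partial n\,\partial n'}(\mathbf r,\mathbf r')=\frac{ik}{4}\frac{H_1(k|x'|)}{|x'|}=\frac{ik^2}{4}\left[H_0(k|x'|)-\dot H_1(k|x'|)\right].$$ *Definition of the regularized integrals.* Accordingly, the hypersingular integral over a segment of length $l$ with basis functions $p_i$, $p_j$ is, formally, $$\varUpsilon_{ij}=k^2I_{ij}-\frac{ik^2}{4}\int_0^l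 dx\,U_{ij}(x),\qquad U_{ij}(x)=p_i(x)\int_{-x}^{l-x}dx'\,\dot H_1(k|x'|)\,p_j(x+x'),$$ where the integrals in $U_{ij}$ diverge. They are regularized as follows. For $\sigma,a,b>0$ put $$\varUpsilon_0(\sigma)=\frac12\lim_{\eta\to0^+}\left[\int_0^\sigma\dot H_1(t-i\eta)\,dt+\int_0^\sigma\dot H_1(t+i\eta)\,dt\right],\qquad \delta\varUpsilon_1(a,b)=\lim_{\eta\to0^+}\left[\int_\eta^b t\,\dot H_1(t)\,dt-\int_\eta^a t\,\dot H_1(t)\,dt\right],$$ and, for $0<x<l$, $$\varUpsilon_\alpha=\frac1k\left\{\varUpsilon_0(kx)+\varUpsilon_0[k(l-x)]\right\},\quad \varUpsilon_\beta=\frac xl\varUpsilon_\alpha,\quad \varUpsilon_\gamma=\varUpsilon_\beta+\frac1{k^2l}\delta\varUpsilon_1\left(kx,k(l-x)\right),\quad \varUpsilon_\delta=\frac xl\varUpsilon_\gamma,$$ $$U_{11}=\varUpsilon_\alpha-\varUpsilon_\beta-\varUpsilon_\gamma+\varUpsilon_\delta,\quad U_{12}=\varUpsilon_\gamma-\varUpsilon_\delta,\quad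 U_{21}=\varUpsilon_\beta-\varUpsilon_\delta,\quad U_{22}=\varUpsilon_\delta.$$ (If the interval $|x'|<\eta$, with $0<\eta<\min(x,l-x)$, is removed from the inner integral in the formal expression for $U_{ij}(x)$, then these formulas hold exactly with $\varUpsilon_0(\sigma)$ replaced by $\int_{k\eta}^{\sigma}\dot H_1(t)\,dt$ and $\delta\varUpsilon_1(a,b)$ replaced by $\int_{k\eta}^bt\dot H_1(t)\,dt-\int_{k\eta}^at\dot H_1(t)\,dt$.) Finally, for $0<\varepsilon<l/2$, $$\varUpsilon_{ij}(\varepsilon)=k^2I_{ij}-\frac{ik^2}{4}\int_\varepsilon^{l-\varepsilon}U_{ij}(x)\,dx .$$ *Result.* The inner and the outer integral defining $I_{ij}$ converge absolutely; all the limits above exist, and all the integrals in the definition of $\varUpsilon_{ij}(\varepsilon)$ converge. For $0<\varepsilon<l/2$, $\varUpsilon_{11}(\varepsilon)=\varUpsilon_{22}(\varepsilon)$ and $\varUpsilon_{12}(\varepsilon)=\varUpsilon_{21}(\varepsilon)$. As $\varepsilon\to0^+$, $$\varUpsilon_{11}(\varepsilon)=\varUpsilon_{22}(\varepsilon)=k^2I_{11}-\frac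 i4H_0(k\varepsilon)+\frac i{2kl}H_1(kl)\mp\frac1{\pi k^2l^2}+o(1),$$ $$\lim_{\varepsilon\to0^+}\varUpsilon_{12}(\varepsilon)=\lim_{\varepsilon\to0^+}\varUpsilon_{21}(\varepsilon)=k^2I_{12}+\frac i4H_0(kl)-\frac i{2kl}H_1(kl)\pm\frac1{\pi k^2l^2},$$ and, with $\gamma$ Euler's constant, $$\lim_{\varepsilon\to0^+}\left[\varUpsilon_{11}(\varepsilon)\mp\frac1{2\pi}\log\varepsilon\right]=\lim_{\varepsilon\to0^+}\left[\varUpsilon_{22}(\varepsilon)\mp\frac1{2\pi}\log\varepsilon\right]=k^2I_{11}+\frac i{2kl}H_1(kl)-\frac i4\pm\frac1{2\pi}\left(\gamma+\log\frac k2-\frac2{k^2l^2}\right).$$ -/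

import Mathlib

open Filter Topology MeasureTheory

noncomputable section

namespace Helmholtz2D

/-- Bessel function of the first kind of order `n`,
`J_n(z) = ∑ (-1)^m / (m! (m+n)!) (z/2)^(2m+n)`. -/
def besselJ (n : ℕ) (z : ℂ) : ℂ :=
  ∑' m : ℕ, (-1 : ℂ) ^ m / ((m.factorial : ℂ) * ((m + n).factorial : ℂ)) * (z / 2) ^ (2 * m + n)

/-- The digamma function at the positive integer `m + 1`: `ψ(m+1) = -γ + ∑_{j=1}^m 1/j`. -/
def digammaSucc (m : ℕ) : ℂ :=
  -((Real.eulerMascheroniConstant : ℝ) : ℂ) + ((harmonic m : ℚ) : ℂ)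

/-- Bessel function of the second kind of integer order `n` (principal branch, cut along the
nonpositive real axis), by its standard series. -/
def besselY (n : ℕ) (z : ℂ) : ℂ :=
  2 / (Real.pi : ℂ) * Complex.log (z / 2) * besselJ n z
    - 1 / (Real.pi : ℂ) * ∑ m ∈ Finset.range n,
        ((n - m - 1).factorial : ℂ) / (m.factorial : ℂ) * (z / 2) ^ (2 * (m : ℤ) - (n : ℤ))
    - 1 / (Real.pi : ℂ) * ∑' m : ℕ,
        (digammaSucc m + digammaSucc (m + n)) *
          ((-1 : ℂ) ^ m / ((m.factorial : ℂ) * ((m + n).factorial : ℂ))) * (z / 2) ^ (2 * m + n)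

/-- The sign `+1` or `-1` as a complex number. -/
def sgn (s : ℤˣ) : ℂ := ((s : ℤ) : ℂ)

/-- Hankel functions `H_n^{(1)} = J_n + i Y_n` (for `s = 1`) and
`H_n^{(2)} = J_n - i Y_n` (for `s = -1`). -/
def hankel (s : ℤˣ) (n : ℕ) (z : ℂ) : ℂ :=
  besselJ n z + sgn s * Complex.I * besselY n z

/-- The derivative of the first order Hankel function. -/
def hankelDot (s : ℤˣ) (z : ℂ) : ℂ := deriv (hankel s 1) z

/-- The Helmholtz kernel `g(r, r') = (i/4) H_0(k |r - r'|)` in the plane. -/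
def green (s : ℤˣ) (k : ℝ) (r r' : EuclideanSpace ℝ (Fin 2)) : ℂ :=
  Complex.I / 4 * hankel s 0 ((k * ‖r - r'‖ : ℝ) : ℂ)

/-- The hypersingular kernel `∂²g / ∂n ∂n'` at `(r, r')`. -/
def hypersingularKernel (s : ℤˣ) (k : ℝ) (n n' r r' : EuclideanSpace ℝ (Fin 2)) : ℂ :=
  deriv (fun t : ℝ => deriv (fun t' : ℝ => green s k (r + t • n) (r' + t' • n')) 0) 0

/-- The two linear basis functions on `[0, l]`: `1 - x/l` (index `0`) and `x/l` (index `1`). -/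
def basis (l : ℝ) (i : Fin 2) (x : ℝ) : ℝ := ![1 - x / l, x / l] i

/-- The integrand of the single layer integral over a coincident element; `x'` is measured
from the point with abscissa `x`. -/
def singleLayerIntegrand (s : ℤˣ) (k l : ℝ) (i j : Fin 2) (x x' : ℝ) : ℂ :=
  hankel s 0 ((k * |x'| : ℝ) : ℂ) * (basis l i x : ℂ) * (basis l j (x' + x) : ℂ)

/-- The single layer integrals `I_{ij}` over a coincident element of length `l`. -/
def singleLayer (s : ℤˣ) (k l : ℝ) (i j : Fin 2) : ℂ :=
  Complex.I / 4 * ∫ x in (0 : ℝ)..l, ∫ x' in (-x)..(l - x), singleLayerIntegrand s k l i j x x'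

/-- The mean of the integrals of the derivative of `H_1` over `[0, σ]` shifted by `∓ i η`. -/
def upsZeroApprox (s : ℤˣ) (σ η : ℝ) : ℂ :=
  1 / 2 * ((∫ x in (0 : ℝ)..σ, hankelDot s ((x : ℂ) - Complex.I * (η : ℂ)))
    + ∫ x in (0 : ℝ)..σ, hankelDot s ((x : ℂ) + Complex.I * (η : ℂ)))

/-- The regularization, by analytic continuation, of the divergent integral
`∫_0^σ H_1'(x) dx`. -/
def upsZero (s : ℤˣ) (σ : ℝ) : ℂ := limUnder (𝓝[>] (0 : ℝ)) (upsZeroApprox s σ)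

/-- Difference of two integrals of `x H_1'(x)`, both cut off at `η`. -/
def upsOneDiffApprox (s : ℤˣ) (a b η : ℝ) : ℂ :=
  (∫ x in η..b, hankelDot s (x : ℂ) * (x : ℂ)) - ∫ x in η..a, hankelDot s (x : ℂ) * (x : ℂ)

/-- The regularization of the difference of the divergent integrals
`∫_0^b x H_1'(x) dx - ∫_0^a x H_1'(x) dx`. -/
def upsOneDiff (s : ℤˣ) (a b : ℝ) : ℂ := limUnder (𝓝[>] (0 : ℝ)) (upsOneDiffApprox s a b)

/-- `∫_{-x}^{l-x} H_1'(k|x'|) dx'` in terms of the values `u`, `v` given to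
`∫_0^{kx} H_1'(t) dt` and `∫_0^{k(l-x)} H_1'(t) dt`. -/
def upsAlpha (k : ℝ) (u v : ℂ) : ℂ := 1 / (k : ℂ) * (u + v)

/-- `(x/l) ∫_{-x}^{l-x} H_1'(k|x'|) dx'` in terms of `u`, `v`. -/
def upsBeta (k l x : ℝ) (u v : ℂ) : ℂ := (x : ℂ) / (l : ℂ) * upsAlpha k u v

/-- `∫_{-x}^{l-x} H_1'(k|x'|) (x'+x)/l dx'` in terms of `u`, `v` and the value `w` given to
`∫_0^{k(l-x)} t H_1'(t) dt - ∫_0^{kx} t H_1'(t) dt`. -/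
def upsGamma (k l x : ℝ) (u v w : ℂ) : ℂ :=
  upsBeta k l x u v + 1 / ((k : ℂ) ^ 2 * (l : ℂ)) * w

/-- `(x/l) ∫_{-x}^{l-x} H_1'(k|x'|) (x'+x)/l dx'` in terms of `u`, `v`, `w`. -/
def upsDelta (k l x : ℝ) (u v w : ℂ) : ℂ := (x : ℂ) / (l : ℂ) * upsGamma k l x u v w

/-- The inner integral `p_i(x) ∫_{-x}^{l-x} H_1'(k|x'|) p_j(x'+x) dx'`, where `p_0`, `p_1` are
the two basis functions, in terms of `u`, `v`, `w`. -/
def upsInnerOf (k l : ℝ) (i j : Fin 2) (x : ℝ) (u v w : ℂ) : ℂ :=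
  !![upsAlpha k u v - upsBeta k l x u v - upsGamma k l x u v w + upsDelta k l x u v w,
      upsGamma k l x u v w - upsDelta k l x u v w;
     upsBeta k l x u v - upsDelta k l x u v w,
      upsDelta k l x u v w] i j

/-- The inner integral with the neighbourhood `|x'| < η` of the singularity removed. -/
def cutInner (s : ℤˣ) (k l : ℝ) (i j : Fin 2) (x η : ℝ) : ℂ :=
  (basis l i x : ℂ) *
    ((∫ x' in (-x)..(-η), hankelDot s ((k * |x'| : ℝ) : ℂ) * (basis l j (x' + x) : ℂ))
      + ∫ x' in η..(l - x), hankelDot s ((k * |x'| : ℝ) : ℂ) * (basis l j (x' + x) : ℂ))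

/-- The regularized inner integral: the divergent integrals are given their regularized
values. -/
def upsInner (s : ℤˣ) (k l : ℝ) (i j : Fin 2) (x : ℝ) : ℂ :=
  upsInnerOf k l i j x (upsZero s (k * x)) (upsZero s (k * (l - x)))
    (upsOneDiff s (k * x) (k * (l - x)))

/-- The hypersingular integrals `Υ_{ij}` over a coincident element of length `l`, with the
outer integration restricted to `[ε, l - ε]` in the part that contains the derivative of
`H_1`. -/
def upsilon (s : ℤˣ) (k l : ℝ) (i j : Fin 2) (ε : ℝ) : ℂ :=
  (k : ℂ) ^ 2 * singleLayer s k l i j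
    - Complex.I * (k : ℂ) ^ 2 / 4 * ∫ x in ε..(l - ε), upsInner s k l i j x

end Helmholtz2D

end

noncomputable section

namespace Helmholtz2D

/-! The whole computation rests on the recurrences H_0' = -H_1 and (z H_1)' = z H_0, hence H_1' =
H_0 - H_1/z, valid on the slit plane and obtained here from the power series
(`hasDerivAt_hankel_zero`, `hasDerivAt_mul_hankel_one`). They make every integral of H_1'
elementary.

Regularization: the mean over the two shifted paths gives Υ_0(σ) = H_1(σ). The endpoint values
H_1(±iη) have opposite poles, and what remains of their sum is a multiple of J_1(iη), which vanishes
with η (`hankel_one_I_mul_add_neg`). Since t H_1' = (t H_1 + H_0)', the cutoff disappears exactly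
from δΥ_1. The inner integrals thus collapse to p_i(x) times a short combination of H_0 and H_1
(`upsInner_eq`).

Outer integral: U_22 has an explicit antiderivative, and U_12 + U_22 is simple because p_1 + p_2 =
1; the reflection x → l - x gives the other two entries. As ε → 0, (l - ε) H_0(kε) produces the
logarithm and ε H_1(kε) → ∓2i/(πk) produces the term 1/(πk²l²). In the off-diagonal entries the two
occurrences of H_0(kε) cancel. -/

/-! ### Entire series in powers of z/2 and their derivatives -/

/-- The series `∑ a_m (z/2)^(2m+n)`. -/
def bseries (a : ℕ → ℂ) (n : ℕ) (z : ℂ) : ℂ := ∑' m : ℕ, a m * (z / 2) ^ (2 * m + n)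

/-- The power series with coefficients `a` converges everywhere. -/
def EntireCoeff (a : ℕ → ℂ) : Prop := ∀ z : ℂ, Summable fun m : ℕ => a m * z ^ m

theorem EntireCoeff.summable_bseries {a : ℕ → ℂ} (ha : EntireCoeff a) (n : ℕ) (z : ℂ) :
    Summable fun m : ℕ => a m * (z / 2) ^ (2 * m + n) := by
  refine ((ha ((z / 2) ^ 2)).mul_right ((z / 2) ^ n)).congr fun m => ?_
  rw [pow_add, pow_mul]; ring

theorem entireCoeff_of_norm_le {a : ℕ → ℂ} (C : ℝ) (h : ∀ m, ‖a m‖ ≤ C / (m.factorial : ℝ)) :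
    EntireCoeff a := by
  intro z
  refine Summable.of_norm_bounded ((Real.summable_pow_div_factorial ‖z‖).mul_left C) fun m => ?_
  rw [norm_mul, norm_pow]
  calc ‖a m‖ * ‖z‖ ^ m ≤ C / (m.factorial : ℝ) * ‖z‖ ^ m := by gcongr; exact h m
    _ = _ := by ring

theorem bseries_eq_pow_mul (a : ℕ → ℂ) (n : ℕ) (z : ℂ) :
    bseries a n z = (z / 2) ^ n * bseries a 0 z := by
  simp only [bseries, ← tsum_mul_left]
  exact tsum_congr fun m => by rw [pow_add, add_zero]; ring

theorem EntireCoeff.bseries_zero_eq {a : ℕ → ℂ} (ha : EntireCoeff a) (z : ℂ) :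
    bseries a 0 z = a 0 + (z / 2) ^ 2 * bseries (fun m => a (m + 1)) 0 z := by
  rw [bseries, (ha.summable_bseries 0 z).tsum_eq_zero_add]
  simp only [bseries, ← tsum_mul_left]
  congr 1
  · simp
  · exact tsum_congr fun m => by ring

theorem bseries_one_neg (a : ℕ → ℂ) (z : ℂ) : bseries a 1 (-z) = -bseries a 1 z := by
  simp only [bseries, ← tsum_neg]
  refine tsum_congr fun m => ?_
  rw [neg_div, Odd.neg_pow ⟨m, rfl⟩]; ring

theorem EntireCoeff.succ {a : ℕ → ℂ} (ha : EntireCoeff a) :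
    EntireCoeff fun m => a (m + 1) := by
  intro z
  rcases eq_or_ne z 0 with rfl | hz
  · exact summable_of_ne_finset_zero (s := {0}) fun m hm => by
      simp [Finset.mem_singleton.not.mp hm]
  · refine (((summable_nat_add_iff 1).mpr (ha z)).mul_right z⁻¹).congr fun m => ?_
    field_simp
    ring

/-- Term by term differentiation. -/
theorem EntireCoeff.hasDerivAt_bseries_zero {a : ℕ → ℂ} (ha : EntireCoeff a) (z : ℂ) :
    HasDerivAt (bseries a 0) (bseries (fun m => (m + 1) * a (m + 1)) 1 z) z := by
  set R : ℝ := ‖z‖ + 1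
  have hz : z ∈ Metric.ball (0 : ℂ) R := by simp [R]
  have hR : 0 ≤ R := by positivity
  have hu : Summable fun m : ℕ => ‖a m‖ * (R / 2) ^ (2 * m) := by
    refine (ha.summable_bseries 0 (R : ℂ)).norm.congr fun m => ?_
    simp [abs_of_nonneg hR]
  have hd : ∀ (m : ℕ) (w : ℂ), HasDerivAt (fun w : ℂ => a m * (w / 2) ^ (2 * m))
      (a m * ((2 * m : ℕ) * (w / 2) ^ (2 * m - 1) * (1 / 2))) w := fun m w =>
    (((hasDerivAt_id w).div_const 2).pow (2 * m)).const_mul (a m)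
  have hle : ∀ (m : ℕ) (w : ℂ), w ∈ Metric.ball (0 : ℂ) R →
      ‖a m * (w / 2) ^ (2 * m)‖ ≤ ‖a m‖ * (R / 2) ^ (2 * m) := by
    intro m w hw
    rw [mem_ball_zero_iff] at hw
    rw [norm_mul, norm_pow, norm_div, Complex.norm_ofNat]
    gcongr
  have hdiff := Complex.differentiableOn_tsum_of_summable_norm hu
    (fun m w _ => (hd m w).differentiableAt.differentiableWithinAt) Metric.isOpen_ball hle
  have hsum := Complex.hasSum_deriv_of_summable_norm hu
    (fun m w _ => (hd m w).differentiableAt.differentiableWithinAt) Metric.isOpen_ball hle hz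
  have h1 := (hdiff.differentiableAt (Metric.isOpen_ball.mem_nhds hz)).hasDerivAt
  have h2 : deriv (fun w : ℂ => ∑' m : ℕ, a m * (w / 2) ^ (2 * m)) z
      = bseries (fun m => (m + 1) * a (m + 1)) 1 z := by
    -- The constant term drops out: the truncated exponent `2 * 0 - 1` stands behind a factor `0`.
    -- The shifted terms carry 2(m + 1)/2 = m + 1.
    rw [← hsum.tsum_eq, hsum.summable.tsum_eq_zero_add]
    simp only [(hd _ _).deriv, bseries]
    rw [Nat.cast_mul, Nat.cast_zero]
    simp only [mul_zero, zero_mul, zero_add]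
    refine tsum_congr fun m => ?_
    rw [show 2 * (m + 1) - 1 = 2 * m + 1 by omega]
    push_cast; ring
  rw [← h2]
  exact h1

theorem EntireCoeff.hasDerivAt_mul_bseries_one {a : ℕ → ℂ} (ha : EntireCoeff a) (z : ℂ) :
    HasDerivAt (fun w => w * bseries a 1 w) (z * bseries (fun m => (m + 1) * a m) 0 z) z := by
  -- Since z (z/2)^(2m+1) = 2 (z/2)^(2(m+1)), multiplying by z gives an even series with shifted
  -- coefficients and no constant term, so the order-zero case applies.
  set b : ℕ → ℂ := fun m => Nat.casesOn m 0 fun j => 2 * a j with hb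
  have hbE : EntireCoeff b := by
    intro w
    refine (summable_nat_add_iff 1).mp (((ha w).mul_left (2 * w)).congr fun m => ?_)
    simp only [hb]; ring
  have h := hbE.hasDerivAt_bseries_zero z
  have h1 : (fun w => w * bseries a 1 w) = bseries b 0 := by
    funext w
    rw [hbE.bseries_zero_eq, bseries_eq_pow_mul, show b 0 = 0 from rfl, zero_add]
    simp only [hb, bseries, ← tsum_mul_left]
    exact tsum_congr fun m => by ring
  rw [h1]
  refine h.congr_deriv ?_
  rw [bseries_eq_pow_mul _ 1]
  simp only [hb, bseries, ← tsum_mul_left]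
  exact tsum_congr fun m => by ring

theorem EntireCoeff.continuous_bseries {a : ℕ → ℂ} (ha : EntireCoeff a) (n : ℕ) :
    Continuous (bseries a n) := by
  rw [show bseries a n = fun z => (z / 2) ^ n * bseries a 0 z from
    funext (bseries_eq_pow_mul a n)]
  have : Continuous (bseries a 0) :=
    continuous_iff_continuousAt.mpr fun z => (ha.hasDerivAt_bseries_zero z).continuousAt
  fun_prop

/-! ### Series of J_n and of the entire part of Y_n -/

/-- Coefficients of the series of `J_n`. -/
def coeffJ (n m : ℕ) : ℂ := (-1 : ℂ) ^ m / ((m.factorial : ℂ) * ((m + n).factorial : ℂ))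

/-- Coefficients of the entire part of `Y_n`. -/
def coeffS (n m : ℕ) : ℂ := (digammaSucc m + digammaSucc (m + n)) * coeffJ n m

theorem norm_coeffJ (n m : ℕ) :
    ‖coeffJ n m‖ = 1 / ((m.factorial : ℝ) * ((m + n).factorial : ℝ)) := by
  simp [coeffJ]

theorem entireCoeff_coeffJ (n : ℕ) : EntireCoeff (coeffJ n) := by
  refine entireCoeff_of_norm_le 1 fun m => ?_
  rw [norm_coeffJ]
  have h1 : (1 : ℝ) ≤ ((m + n).factorial : ℝ) := by exact_mod_cast Nat.factorial_pos _
  have h2 : (0 : ℝ) < (m.factorial : ℝ) := by positivity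
  gcongr
  nlinarith

theorem harmonic_le_self (m : ℕ) : harmonic m ≤ m := by
  rw [harmonic]
  calc ∑ i ∈ Finset.range m, ((i + 1 : ℕ) : ℚ)⁻¹ ≤ ∑ i ∈ Finset.range m, (1 : ℚ) :=
        Finset.sum_le_sum fun i _ => inv_le_one_of_one_le₀ (by simp)
    _ = m := by simp

/-- Growth like m! is affordable: `coeffJ` has two factorials in its denominator, and one is enough
for convergence everywhere. -/
theorem norm_digammaSucc_le (m : ℕ) : ‖digammaSucc m‖ ≤ 2 * (m.factorial : ℝ) := by
  have h0 : (0 : ℚ) ≤ harmonic m := Finset.sum_nonneg fun i _ => by positivity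
  have h1 : ‖((harmonic m : ℚ) : ℂ)‖ ≤ m := by
    rw [show ((harmonic m : ℚ) : ℂ) = (((harmonic m : ℚ) : ℝ) : ℂ) by norm_cast,
      Complex.norm_real, Real.norm_of_nonneg (by exact_mod_cast h0)]
    exact_mod_cast harmonic_le_self m
  have h2 : ‖-((Real.eulerMascheroniConstant : ℝ) : ℂ)‖ ≤ 1 := by
    rw [norm_neg, Complex.norm_real, Real.norm_eq_abs, abs_le]
    constructor <;>
      linarith [Real.one_half_lt_eulerMascheroniConstant,
        Real.eulerMascheroniConstant_lt_two_thirds]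
  have h3 : (m : ℝ) ≤ (m.factorial : ℝ) := by exact_mod_cast Nat.self_le_factorial m
  have h4 : (1 : ℝ) ≤ (m.factorial : ℝ) := by exact_mod_cast Nat.factorial_pos m
  exact (norm_add_le _ _).trans (by linarith)

theorem entireCoeff_coeffS (n : ℕ) : EntireCoeff (coeffS n) := by
  refine entireCoeff_of_norm_le 4 fun m => ?_
  rw [coeffS, norm_mul, norm_coeffJ]
  have h1 : ‖digammaSucc m + digammaSucc (m + n)‖ ≤ 4 * ((m + n).factorial : ℝ) := by
    have h2 : (m.factorial : ℝ) ≤ ((m + n).factorial : ℝ) := by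
      exact_mod_cast Nat.factorial_le (Nat.le_add_right m n)
    linarith [norm_add_le (digammaSucc m) (digammaSucc (m + n)), norm_digammaSucc_le m,
      norm_digammaSucc_le (m + n)]
  calc ‖digammaSucc m + digammaSucc (m + n)‖ * (1 / ((m.factorial : ℝ) * ((m + n).factorial : ℝ)))
      ≤ 4 * ((m + n).factorial : ℝ) * (1 / ((m.factorial : ℝ) * ((m + n).factorial : ℝ))) := by
        gcongr
    _ = 4 / (m.factorial : ℝ) := by field_simp

theorem digammaSucc_succ (m : ℕ) : digammaSucc (m + 1) = digammaSucc m + 1 / ((m : ℂ) + 1) := by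
  simp only [digammaSucc, harmonic_succ]
  push_cast
  ring

theorem besselJ_eq (n : ℕ) (z : ℂ) : besselJ n z = bseries (coeffJ n) n z := rfl

theorem continuous_besselJ (n : ℕ) : Continuous (besselJ n) :=
  (entireCoeff_coeffJ n).continuous_bseries n

/-- The entire part of `Y_n`. -/
def besselS (n : ℕ) (z : ℂ) : ℂ := bseries (coeffS n) n z

theorem continuous_besselS (n : ℕ) : Continuous (besselS n) :=
  (entireCoeff_coeffS n).continuous_bseries n

/-- Coefficient form of J_0' = -J_1; the next lemma is that of (z J_1)' = z J_0. -/
theorem succ_mul_coeffJ_zero (m : ℕ) :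
    ((m : ℂ) + 1) * coeffJ 0 (m + 1) = -coeffJ 1 m := by
  have h : ((m : ℂ) + 1) ≠ 0 := by exact_mod_cast Nat.succ_ne_zero m
  have h' : (m.factorial : ℂ) ≠ 0 := by exact_mod_cast m.factorial_ne_zero
  simp only [coeffJ, add_zero, Nat.factorial_succ]
  push_cast
  field_simp
  ring

theorem succ_mul_coeffJ_one (m : ℕ) : ((m : ℂ) + 1) * coeffJ 1 m = coeffJ 0 m := by
  have h : ((m : ℂ) + 1) ≠ 0 := by exact_mod_cast Nat.succ_ne_zero m
  have h' : (m.factorial : ℂ) ≠ 0 := by exact_mod_cast m.factorial_ne_zero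
  simp only [coeffJ, add_zero, Nat.factorial_succ]
  push_cast
  field_simp

theorem hasDerivAt_besselJ_zero (z : ℂ) : HasDerivAt (besselJ 0) (-besselJ 1 z) z := by
  refine ((entireCoeff_coeffJ 0).hasDerivAt_bseries_zero z).congr_deriv ?_
  simp only [besselJ_eq, bseries, ← tsum_neg, succ_mul_coeffJ_zero, neg_mul]

theorem hasDerivAt_mul_besselJ_one (z : ℂ) :
    HasDerivAt (fun w => w * besselJ 1 w) (z * besselJ 0 z) z := by
  refine ((entireCoeff_coeffJ 1).hasDerivAt_mul_bseries_one z).congr_deriv ?_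
  simp only [besselJ_eq, succ_mul_coeffJ_one]

theorem besselJ_zero_eq (z : ℂ) :
    besselJ 0 z = 1 + (z / 2) ^ 2 * bseries (fun m => coeffJ 0 (m + 1)) 0 z := by
  rw [besselJ_eq, (entireCoeff_coeffJ 0).bseries_zero_eq]
  simp [coeffJ]

/-- Because 2ψ(m+2) = ψ(m+1) + ψ(m+2) + 1/(m+1), differentiation leaves an extra series, which sums
to (2/z)(J_0 - 1). In Y_0' its J_0 part cancels the derivative of the logarithm, and its -1 part
supplies the pole of Y_1. -/
theorem hasDerivAt_besselS_zero (z : ℂ) (hz : z ≠ 0) :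
    HasDerivAt (besselS 0) (-besselS 1 z + 2 / z * (besselJ 0 z - 1)) z := by
  refine ((entireCoeff_coeffS 0).hasDerivAt_bseries_zero z).congr_deriv ?_
  have h1 : ∀ m : ℕ, ((m : ℂ) + 1) * coeffS 0 (m + 1) = -coeffS 1 m + coeffJ 0 (m + 1) := by
    intro m
    have h : ((m : ℂ) + 1) ≠ 0 := by exact_mod_cast Nat.succ_ne_zero m
    have h2 : coeffJ 1 m = -(((m : ℂ) + 1) * coeffJ 0 (m + 1)) := by
      rw [succ_mul_coeffJ_zero, neg_neg]
    simp only [coeffS, add_zero, digammaSucc_succ, h2]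
    field_simp
    ring
  rw [besselJ_zero_eq, besselS, bseries_eq_pow_mul _ 1]
  simp only [h1]
  rw [bseries_eq_pow_mul _ 1]
  have h3 : bseries (fun m => -coeffS 1 m + coeffJ 0 (m + 1)) 0 z
      = -bseries (coeffS 1) 0 z + bseries (fun m => coeffJ 0 (m + 1)) 0 z := by
    simp only [bseries, add_mul, neg_mul]
    rw [Summable.tsum_add, tsum_neg]
    · exact ((entireCoeff_coeffS 1).summable_bseries 0 z).neg
    · exact (entireCoeff_coeffJ 0).succ.summable_bseries 0 z
  rw [h3]
  field_simp
  ring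

/-- The extra 2 J_1, again from the increment of ψ, cancels the derivative of the logarithm in (z
Y_1)'. -/
theorem hasDerivAt_mul_besselS_one (z : ℂ) :
    HasDerivAt (fun w => w * besselS 1 w) (z * besselS 0 z + 2 * besselJ 1 z) z := by
  refine ((entireCoeff_coeffS 1).hasDerivAt_mul_bseries_one z).congr_deriv ?_
  have h1 : ∀ m : ℕ, ((m : ℂ) + 1) * coeffS 1 m = coeffS 0 m + coeffJ 1 m := by
    intro m
    have h : ((m : ℂ) + 1) ≠ 0 := by exact_mod_cast Nat.succ_ne_zero m
    simp only [coeffS, add_zero, digammaSucc_succ, ← succ_mul_coeffJ_one m]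
    field_simp
    ring
  simp only [h1]
  rw [besselS, besselJ_eq, bseries_eq_pow_mul _ 1]
  have h3 : bseries (fun m => coeffS 0 m + coeffJ 1 m) 0 z
      = bseries (coeffS 0) 0 z + bseries (coeffJ 1) 0 z := by
    simp only [bseries, add_mul]
    rw [Summable.tsum_add]
    · exact (entireCoeff_coeffS 0).summable_bseries 0 z
    · exact (entireCoeff_coeffJ 1).summable_bseries 0 z
  rw [h3]
  ring

/-! ### Recurrences for the Hankel functions on the slit plane -/

theorem besselY_zero_eq (z : ℂ) :
    besselY 0 z = 2 / (Real.pi : ℂ) * Complex.log (z / 2) * besselJ 0 z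
      - 1 / (Real.pi : ℂ) * besselS 0 z := by
  simp only [besselY, besselS, bseries, coeffS, coeffJ, Finset.range_zero, Finset.sum_empty]
  ring

theorem besselY_one_eq (z : ℂ) :
    besselY 1 z = 2 / (Real.pi : ℂ) * Complex.log (z / 2) * besselJ 1 z
      - 2 / ((Real.pi : ℂ) * z) - 1 / (Real.pi : ℂ) * besselS 1 z := by
  simp only [besselY, besselS, bseries, coeffS, coeffJ, Finset.range_one, Finset.sum_singleton]
  norm_num [zpow_neg]
  ring

theorem hasDerivAt_log_half {z : ℂ} (hz : z ∈ Complex.slitPlane) :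
    HasDerivAt (fun w : ℂ => Complex.log (w / 2)) (1 / z) z := by
  have h0 := Complex.slitPlane_ne_zero hz
  have h2 : z / 2 ∈ Complex.slitPlane := by
    rw [Complex.mem_slitPlane_iff] at hz ⊢
    simpa using hz
  refine (((hasDerivAt_id z).div_const 2).clog h2).congr_deriv ?_
  simp only [id]
  field_simp

theorem hasDerivAt_hankel_zero (s : ℤˣ) {z : ℂ} (hz : z ∈ Complex.slitPlane) :
    HasDerivAt (hankel s 0) (-hankel s 1 z) z := by
  have h0 := Complex.slitPlane_ne_zero hz
  have hpi : (Real.pi : ℂ) ≠ 0 := by exact_mod_cast Real.pi_ne_zero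
  have hY : HasDerivAt (besselY 0) (-besselY 1 z) z := by
    rw [show besselY 0 = _ from funext besselY_zero_eq]
    refine ((((hasDerivAt_log_half hz).const_mul (2 / (Real.pi : ℂ))).mul
      (hasDerivAt_besselJ_zero z)).sub
      ((hasDerivAt_besselS_zero z h0).const_mul (1 / (Real.pi : ℂ)))).congr_deriv ?_
    rw [besselY_one_eq]
    field_simp
    ring
  refine ((hasDerivAt_besselJ_zero z).add (hY.const_mul (sgn s * Complex.I))).congr_deriv ?_
  simp only [hankel]; ring

theorem hasDerivAt_mul_hankel_one (s : ℤˣ) {z : ℂ} (hz : z ∈ Complex.slitPlane) :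
    HasDerivAt (fun w => w * hankel s 1 w) (z * hankel s 0 z) z := by
  have h0 := Complex.slitPlane_ne_zero hz
  have hpi : (Real.pi : ℂ) ≠ 0 := by exact_mod_cast Real.pi_ne_zero
  have hY : HasDerivAt (fun w => w * besselY 1 w) (z * besselY 0 z) z := by
    have h := ((((hasDerivAt_log_half hz).const_mul (2 / (Real.pi : ℂ))).mul
      (hasDerivAt_mul_besselJ_one z)).sub_const (2 / (Real.pi : ℂ))).sub
      ((hasDerivAt_mul_besselS_one z).const_mul (1 / (Real.pi : ℂ)))
    have h' := h.congr_of_eventuallyEq (f₁ := fun w => w * besselY 1 w) (by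
      filter_upwards [isOpen_ne.mem_nhds h0] with w hw
      have hw' : w ≠ 0 := hw
      simp only [besselY_one_eq, Pi.mul_apply, Pi.sub_apply]
      field_simp)
    refine h'.congr_deriv ?_
    rw [besselY_zero_eq]
    field_simp
    ring
  have h := (hasDerivAt_mul_besselJ_one z).add (hY.const_mul (sgn s * Complex.I))
  have h' := h.congr_of_eventuallyEq (f₁ := fun w => w * hankel s 1 w) (.of_forall fun w => by
    simp only [hankel, Pi.add_apply]; ring)
  refine h'.congr_deriv ?_
  simp only [hankel]; ring

theorem hasDerivAt_hankel_one (s : ℤˣ) {z : ℂ} (hz : z ∈ Complex.slitPlane) :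
    HasDerivAt (hankel s 1) (hankel s 0 z - hankel s 1 z / z) z := by
  have h0 := Complex.slitPlane_ne_zero hz
  have h := (hasDerivAt_mul_hankel_one s hz).div (hasDerivAt_id z) h0
  have h' := h.congr_of_eventuallyEq (f₁ := hankel s 1) (by
    filter_upwards [isOpen_ne.mem_nhds h0] with w hw
    have hw' : w ≠ 0 := hw
    simp only [Pi.div_apply, id]
    field_simp)
  refine h'.congr_deriv ?_
  simp only [id]
  field_simp

theorem hankelDot_eq (s : ℤˣ) {z : ℂ} (hz : z ∈ Complex.slitPlane) :
    hankelDot s z = hankel s 0 z - hankel s 1 z / z :=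
  (hasDerivAt_hankel_one s hz).deriv

theorem hasDerivAt_hankel_one' (s : ℤˣ) {z : ℂ} (hz : z ∈ Complex.slitPlane) :
    HasDerivAt (hankel s 1) (hankelDot s z) z :=
  (hasDerivAt_hankel_one s hz).differentiableAt.hasDerivAt

theorem continuousOn_hankel_zero (s : ℤˣ) : ContinuousOn (hankel s 0) Complex.slitPlane :=
  fun _ hz => (hasDerivAt_hankel_zero s hz).continuousAt.continuousWithinAt

theorem continuousOn_hankel_one (s : ℤˣ) : ContinuousOn (hankel s 1) Complex.slitPlane :=
  fun _ hz => (hasDerivAt_hankel_one s hz).continuousAt.continuousWithinAt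

theorem continuousOn_hankelDot (s : ℤˣ) : ContinuousOn (hankelDot s) Complex.slitPlane :=
  ((continuousOn_hankel_zero s).sub ((continuousOn_hankel_one s).div continuousOn_id
    fun _ hz => Complex.slitPlane_ne_zero hz)).congr fun _ hz => hankelDot_eq s hz

theorem ofReal_mem_slitPlane_of_pos {t : ℝ} (ht : 0 < t) : (t : ℂ) ∈ Complex.slitPlane :=
  Complex.ofReal_mem_slitPlane.mpr ht

theorem continuousOn_comp_ofReal {f : ℂ → ℂ} (hf : ContinuousOn f Complex.slitPlane) :
    ContinuousOn (fun t : ℝ => f (t : ℂ)) (Set.Ioi 0) :=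
  hf.comp Complex.continuous_ofReal.continuousOn fun _ ht => ofReal_mem_slitPlane_of_pos ht

theorem uIcc_subset_Ioi {a b : ℝ} (ha : 0 < a) (hb : 0 < b) : Set.uIcc a b ⊆ Set.Ioi 0 :=
  fun _ ht => (lt_min ha hb).trans_le ht.1

theorem intervalIntegrable_hankelDot (s : ℤˣ) {a b : ℝ} (ha : 0 < a) (hb : 0 < b) :
    IntervalIntegrable (fun t : ℝ => hankelDot s (t : ℂ)) volume a b :=
  ((continuousOn_comp_ofReal (continuousOn_hankelDot s)).mono
    (uIcc_subset_Ioi ha hb)).intervalIntegrable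

theorem intervalIntegrable_hankelDot_mul (s : ℤˣ) {a b : ℝ} (ha : 0 < a) (hb : 0 < b) :
    IntervalIntegrable (fun t : ℝ => hankelDot s (t : ℂ) * (t : ℂ)) volume a b :=
  (intervalIntegrable_hankelDot s ha hb).mul_continuousOn Complex.continuous_ofReal.continuousOn

/-! ### Regularization of the integral of the derivative of `H_1` -/

theorem ofReal_add_mem_slitPlane {c : ℂ} (hc : c.im ≠ 0) (x : ℝ) :
    (x : ℂ) + c ∈ Complex.slitPlane :=
  Complex.mem_slitPlane_iff.mpr (Or.inr (by simpa using hc))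

theorem intervalIntegrable_hankelDot_add (s : ℤˣ) {c : ℂ} (hc : c.im ≠ 0) (a b : ℝ) :
    IntervalIntegrable (fun x : ℝ => hankelDot s ((x : ℂ) + c)) volume a b :=
  ((continuousOn_hankelDot s).comp (s := Set.univ) (f := fun x : ℝ => (x : ℂ) + c)
    (by fun_prop) fun x _ => ofReal_add_mem_slitPlane hc x).mono (Set.subset_univ _)
    |>.intervalIntegrable

/-- A horizontal path off the real axis meets neither the cut nor the pole, so H_1 itself serves as
antiderivative. -/
theorem integral_hankelDot_add (s : ℤˣ) {c : ℂ} (hc : c.im ≠ 0) (a b : ℝ) :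
    ∫ x in a..b, hankelDot s ((x : ℂ) + c) = hankel s 1 (b + c) - hankel s 1 (a + c) := by
  refine intervalIntegral.integral_eq_sub_of_hasDerivAt
    (f := fun x : ℝ => hankel s 1 ((x : ℂ) + c)) (fun x _ => ?_)
    (intervalIntegrable_hankelDot_add s hc a b)
  have h := hasDerivAt_hankel_one' s (ofReal_add_mem_slitPlane hc x)
  exact (h.comp_add_const (x : ℂ) c).comp_ofReal

/-- J_1, the pole 1/z and the entire part of Y_1 are odd, so only the jump log(iη/2) - log(-iη/2) =
iπ multiplying J_1 survives. -/
theorem hankel_one_I_mul_add_neg (s : ℤˣ) {η : ℝ} (hη : 0 < η) :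
    hankel s 1 (Complex.I * η) + hankel s 1 (-(Complex.I * η))
      = -2 * sgn s * besselJ 1 (Complex.I * η) := by
  have hJ : besselJ 1 (-(Complex.I * η)) = -besselJ 1 (Complex.I * η) := bseries_one_neg _ _
  have hS : besselS 1 (-(Complex.I * η)) = -besselS 1 (Complex.I * η) := bseries_one_neg _ _
  have h1 : Complex.log (Complex.I * η / 2) = (Real.log (η / 2) : ℝ) + Real.pi / 2 * Complex.I := by
    rw [show Complex.I * (η : ℂ) / 2 = ((η / 2 : ℝ) : ℂ) * Complex.I by push_cast; ring,
      Complex.log_ofReal_mul (by positivity) Complex.I_ne_zero, Complex.log_I]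
  have h2 : Complex.log (-(Complex.I * η) / 2)
      = (Real.log (η / 2) : ℝ) - Real.pi / 2 * Complex.I := by
    rw [show -(Complex.I * (η : ℂ)) / 2 = ((η / 2 : ℝ) : ℂ) * -Complex.I by push_cast; ring,
      Complex.log_ofReal_mul (by positivity) (neg_ne_zero.mpr Complex.I_ne_zero),
      Complex.log_neg_I]
    ring
  have hpi : (Real.pi : ℂ) ≠ 0 := by exact_mod_cast Real.pi_ne_zero
  have hη' : (η : ℂ) ≠ 0 := by exact_mod_cast hη.ne'
  have hI := Complex.I_ne_zero
  simp only [hankel, besselY_one_eq, h1, h2, hJ, hS]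
  field_simp
  ring_nf
  simp only [Complex.I_sq]
  ring

/-- At the upper endpoint H_1 is continuous; the lower endpoint contributes a multiple of J_1(iη),
which tends to J_1(0) = 0. -/
theorem tendsto_upsZeroApprox (s : ℤˣ) {σ : ℝ} (hσ : 0 < σ) :
    Tendsto (upsZeroApprox s σ) (𝓝[>] 0) (𝓝 (hankel s 1 σ)) := by
  have heq : ∀ᶠ η : ℝ in 𝓝[>] 0, 1 / 2 * (hankel s 1 ((σ : ℂ) + -(Complex.I * η))
      + hankel s 1 ((σ : ℂ) + Complex.I * η)) + sgn s * besselJ 1 (Complex.I * η)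
      = upsZeroApprox s σ η := by
    filter_upwards [self_mem_nhdsWithin] with η hη
    have hη : 0 < η := hη
    have hc : (Complex.I * (η : ℂ)).im ≠ 0 := by simpa using hη.ne'
    have hc' : (-(Complex.I * (η : ℂ))).im ≠ 0 := by simpa using hη.ne'
    simp only [upsZeroApprox, sub_eq_add_neg]
    rw [integral_hankelDot_add s hc, integral_hankelDot_add s hc']
    have h := hankel_one_I_mul_add_neg s hη
    simp only [Complex.ofReal_zero, zero_add]
    linear_combination (1 / 2) * h
  refine Tendsto.congr' heq ?_
  have hmem := ofReal_mem_slitPlane_of_pos hσ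
  have hH : ContinuousAt (hankel s 1) ((σ : ℂ) + 0) := by
    rw [add_zero]; exact (hasDerivAt_hankel_one s hmem).continuousAt
  have hlin : Tendsto (fun η : ℝ => Complex.I * (η : ℂ)) (𝓝[>] 0) (𝓝 0) := by
    have : Continuous fun η : ℝ => Complex.I * (η : ℂ) := by fun_prop
    simpa using (this.tendsto 0).mono_left nhdsWithin_le_nhds
  have hneg : Tendsto (fun η : ℝ => -(Complex.I * (η : ℂ))) (𝓝[>] 0) (𝓝 0) := by
    simpa using hlin.neg
  have hJ := ((continuous_besselJ 1).tendsto 0).comp hlin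
  have hJ0 : besselJ 1 0 = 0 := by rw [besselJ_eq, bseries_eq_pow_mul]; simp
  have t1 := hH.tendsto.comp (hneg.const_add (σ : ℂ))
  have t2 := hH.tendsto.comp (hlin.const_add (σ : ℂ))
  have h := ((t1.add t2).const_mul (1 / 2)).add (hJ.const_mul (sgn s))
  rw [hJ0, add_zero, show 1 / 2 * (hankel s 1 σ + hankel s 1 σ) + sgn s * 0 = hankel s 1 σ by
    ring] at h
  exact h

theorem upsZero_eq (s : ℤˣ) {σ : ℝ} (hσ : 0 < σ) : upsZero s σ = hankel s 1 σ :=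
  (tendsto_upsZeroApprox s hσ).limUnder_eq

/-- (t H_1 + H_0)' = t H_0 - H_1 = t H_1'. -/
theorem integral_hankelDot_mul (s : ℤˣ) {a b : ℝ} (ha : 0 < a) (hb : 0 < b) :
    ∫ t in a..b, hankelDot s (t : ℂ) * (t : ℂ)
      = (b * hankel s 1 b + hankel s 0 b) - (a * hankel s 1 a + hankel s 0 a) := by
  refine intervalIntegral.integral_eq_sub_of_hasDerivAt
    (f := fun t : ℝ => (t : ℂ) * hankel s 1 t + hankel s 0 t) (fun t ht => ?_)
    (intervalIntegrable_hankelDot_mul s ha hb)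
  have hm := ofReal_mem_slitPlane_of_pos (uIcc_subset_Ioi ha hb ht)
  have h0 := Complex.slitPlane_ne_zero hm
  refine (((hasDerivAt_mul_hankel_one s hm).add (hasDerivAt_hankel_zero s hm)).comp_ofReal
    ).congr_deriv ?_
  rw [hankelDot_eq s hm]
  field_simp
  ring

/-- For η > 0 the approximant does not depend on η: the contributions at the common lower limit
cancel. -/
theorem tendsto_upsOneDiffApprox (s : ℤˣ) {a b : ℝ} (ha : 0 < a) (hb : 0 < b) :
    Tendsto (upsOneDiffApprox s a b) (𝓝[>] 0)
      (𝓝 ((b * hankel s 1 b + hankel s 0 b) - (a * hankel s 1 a + hankel s 0 a))) := by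
  refine Tendsto.congr' ?_ tendsto_const_nhds
  filter_upwards [self_mem_nhdsWithin] with η hη
  rw [upsOneDiffApprox, integral_hankelDot_mul s hη ha, integral_hankelDot_mul s hη hb]
  ring

theorem upsOneDiff_eq (s : ℤˣ) {a b : ℝ} (ha : 0 < a) (hb : 0 < b) :
    upsOneDiff s a b
      = (b * hankel s 1 b + hankel s 0 b) - (a * hankel s 1 a + hankel s 0 a) :=
  (tendsto_upsOneDiffApprox s ha hb).limUnder_eq

/-! ### The inner integral with the singularity cut out -/

/-- The slopes of the two basis functions. -/
def basisSlope (l : ℝ) (j : Fin 2) : ℝ := ![-(1 / l), 1 / l] j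

theorem basis_add (l : ℝ) (j : Fin 2) (x t : ℝ) :
    basis l j (t + x) = basis l j x + basisSlope l j * t := by
  fin_cases j <;> simp [basis, basisSlope] <;> ring

theorem continuous_basis (l : ℝ) (j : Fin 2) : Continuous (basis l j) := by
  fin_cases j
  · exact (continuous_const.sub (continuous_id.div_const l) : Continuous fun x : ℝ => 1 - x / l)
  · exact (continuous_id.div_const l : Continuous fun x : ℝ => x / l)

theorem integral_hankelDot_mul_affine (s : ℤˣ) {k a b : ℝ} (hk : 0 < k) (ha : 0 < a) (hb : 0 < b)
    (p q : ℂ) :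
    ∫ t in a..b, hankelDot s ((k * t : ℝ) : ℂ) * (p + q * (t : ℂ))
      = p / k * (∫ t in (k * a)..(k * b), hankelDot s (t : ℂ))
        + q / (k : ℂ) ^ 2 * ∫ t in (k * a)..(k * b), hankelDot s (t : ℂ) * (t : ℂ) := by
  have hk' : (k : ℂ) ≠ 0 := by exact_mod_cast hk.ne'
  have hc : ContinuousOn (fun t : ℝ => hankelDot s ((k * t : ℝ) : ℂ)) (Set.uIcc a b) :=
    (continuousOn_comp_ofReal (continuousOn_hankelDot s)).comp (by fun_prop)
      fun t ht => mul_pos hk (uIcc_subset_Ioi ha hb ht)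
  have h1 := intervalIntegral.integral_comp_mul_left (a := a) (b := b)
    (fun t : ℝ => hankelDot s (t : ℂ)) hk.ne'
  have h2 := intervalIntegral.integral_comp_mul_left (a := a) (b := b)
    (fun t : ℝ => hankelDot s (t : ℂ) * (t : ℂ)) hk.ne'
  have h1' : ∫ t in (k * a)..(k * b), hankelDot s (t : ℂ)
      = k * ∫ t in a..b, hankelDot s ((k * t : ℝ) : ℂ) := by
    rw [h1, Complex.real_smul, Complex.ofReal_inv, mul_inv_cancel_left₀ hk']
  have h2' : ∫ t in (k * a)..(k * b), hankelDot s (t : ℂ) * (t : ℂ)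
      = k * ∫ t in a..b, k * (hankelDot s ((k * t : ℝ) : ℂ) * (t : ℂ)) := by
    rw [show (fun t : ℝ => (k : ℂ) * (hankelDot s ((k * t : ℝ) : ℂ) * (t : ℂ)))
        = fun t : ℝ => hankelDot s ((k * t : ℝ) : ℂ) * ((k * t : ℝ) : ℂ) by
          funext t; push_cast; ring,
      h2, Complex.real_smul, Complex.ofReal_inv, mul_inv_cancel_left₀ hk']
  rw [intervalIntegral.integral_const_mul] at h2'
  rw [h1', h2', show (fun t : ℝ => hankelDot s ((k * t : ℝ) : ℂ) * (p + q * (t : ℂ)))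
      = fun t : ℝ => p * hankelDot s ((k * t : ℝ) : ℂ)
        + q * (hankelDot s ((k * t : ℝ) : ℂ) * (t : ℂ)) by funext t; ring,
    intervalIntegral.integral_add, intervalIntegral.integral_const_mul,
    intervalIntegral.integral_const_mul]
  · field_simp
  · exact (hc.intervalIntegrable).const_mul p
  · exact ((hc.mul Complex.continuous_ofReal.continuousOn).intervalIntegrable).const_mul q

/-- Folding the negative half by t → -t reverses the slope of the basis function. Its constant part
therefore meets the sum of the two half integrals, its slope their difference. -/
theorem cutInner_eq (s : ℤˣ) {k l : ℝ} (hk : 0 < k) (hl : 0 < l) (i j : Fin 2) {x η : ℝ}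
    (hη : 0 < η) (hx : η < x) (hx' : η < l - x) :
    cutInner s k l i j x η
      = upsInnerOf k l i j x (∫ t in (k * η)..(k * x), hankelDot s (t : ℂ))
          (∫ t in (k * η)..(k * (l - x)), hankelDot s (t : ℂ))
          (upsOneDiffApprox s (k * x) (k * (l - x)) (k * η)) := by
  have h1 : ∫ x' in (-x)..(-η), hankelDot s ((k * |x'| : ℝ) : ℂ) * (basis l j (x' + x) : ℂ)
      = ∫ t in η..x, hankelDot s ((k * t : ℝ) : ℂ)
          * ((basis l j x : ℂ) + (-(basisSlope l j : ℂ)) * (t : ℂ)) := by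
    rw [← intervalIntegral.integral_comp_neg
      (fun x' : ℝ => hankelDot s ((k * |x'| : ℝ) : ℂ) * (basis l j (x' + x) : ℂ))]
    refine intervalIntegral.integral_congr fun t ht => ?_
    have ht : 0 < t := uIcc_subset_Ioi hη (hη.trans hx) ht
    simp only [abs_neg, abs_of_pos ht, basis_add]
    push_cast; ring
  have h2 : ∫ x' in η..(l - x), hankelDot s ((k * |x'| : ℝ) : ℂ) * (basis l j (x' + x) : ℂ)
      = ∫ t in η..(l - x), hankelDot s ((k * t : ℝ) : ℂ)
          * ((basis l j x : ℂ) + (basisSlope l j : ℂ) * (t : ℂ)) := by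
    refine intervalIntegral.integral_congr fun t ht => ?_
    have ht : 0 < t := uIcc_subset_Ioi hη (hη.trans hx') ht
    simp only [abs_of_pos ht, basis_add]
    push_cast; ring
  have hk' : (k : ℂ) ≠ 0 := by exact_mod_cast hk.ne'
  have hl' : (l : ℂ) ≠ 0 := by exact_mod_cast hl.ne'
  rw [cutInner, h1, h2, integral_hankelDot_mul_affine s hk hη (hη.trans hx),
    integral_hankelDot_mul_affine s hk hη (hη.trans hx'), upsOneDiffApprox]
  fin_cases i <;> fin_cases j <;>
    simp [-mul_eq_mul_left_iff, basis, basisSlope, upsInnerOf, upsAlpha, upsBeta, upsGamma, upsDelta] <;>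
    field_simp <;> ring

/-! ### The single layer integrals -/

theorem intervalIntegrable_hankel_zero (s : ℤˣ) {k : ℝ} (hk : 0 < k) (a b : ℝ) :
    IntervalIntegrable (fun t : ℝ => hankel s 0 ((k * |t| : ℝ) : ℂ)) volume a b := by
  have hlog : IntervalIntegrable (fun t : ℝ => Real.log (k / 2 * t)) volume a b := by
    have hk2 : k / 2 ≠ 0 := by positivity
    have h := (intervalIntegral.intervalIntegrable_log' (a := k / 2 * a) (b := k / 2 * b)
      ).comp_mul_left (c := k / 2)
    simpa [mul_div_cancel_left₀, hk2, hk.ne'] using h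
  have hlog' : IntervalIntegrable (fun t : ℝ => ((Real.log (k / 2 * t) : ℝ) : ℂ)) volume a b :=
    ⟨hlog.1.ofReal, hlog.2.ofReal⟩
  have hin : Continuous fun t : ℝ => ((k * |t| : ℝ) : ℂ) := by fun_prop
  have hJ := (continuous_besselJ 0).comp hin
  have hS := (continuous_besselS 0).comp hin
  have h := ((hlog'.mul_continuousOn hJ.continuousOn).const_mul
    (sgn s * Complex.I * (2 / (Real.pi : ℂ)))).add
      ((hJ.sub (hS.const_mul (sgn s * Complex.I / (Real.pi : ℂ)))).intervalIntegrable a b)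
  refine h.congr fun t _ => ?_
  -- `Real.log` ignores the sign, and both logarithms take the value 0 at 0, so this holds for every
  -- t, including t = 0.
  have hl : Complex.log (((k * |t| : ℝ) : ℂ) / 2) = ((Real.log (k / 2 * t) : ℝ) : ℂ) := by
    rw [← Real.log_abs (k / 2 * t), abs_mul, abs_of_pos (by positivity : 0 < k / 2),
      Complex.ofReal_log (by positivity)]
    congr 1
    push_cast; ring
  simp only [hankel, besselY_zero_eq, hl, Function.comp_apply, Pi.sub_apply]
  ring

theorem intervalIntegrable_singleLayerIntegrand (s : ℤˣ) {k : ℝ} (hk : 0 < k) (l : ℝ)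
    (i j : Fin 2) (x a b : ℝ) :
    IntervalIntegrable (singleLayerIntegrand s k l i j x) volume a b := by
  have hc := continuous_basis l j
  exact ((intervalIntegrable_hankel_zero s hk a b).mul_const _).mul_continuousOn
    (by fun_prop : Continuous fun x' : ℝ => (basis l j (x' + x) : ℂ)).continuousOn

/-- The basis function is affine in x', so the inner integral is a combination of primitives of
H_0(k|t|) and t H_0(k|t|), which are continuous. This gives integrability of the outer integrand. -/
theorem continuous_integral_singleLayerIntegrand (s : ℤˣ) {k : ℝ} (hk : 0 < k) (l : ℝ)
    (i j : Fin 2) :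
    Continuous fun x : ℝ => ∫ x' in (-x)..(l - x), singleLayerIntegrand s k l i j x x' := by
  set f : ℝ → ℂ := fun t => hankel s 0 ((k * |t| : ℝ) : ℂ)
  set g : ℝ → ℂ := fun t => f t * (t : ℂ)
  have hf : ∀ a b, IntervalIntegrable f volume a b := intervalIntegrable_hankel_zero s hk
  have hg : ∀ a b, IntervalIntegrable g volume a b := fun a b =>
    (hf a b).mul_continuousOn Complex.continuous_ofReal.continuousOn
  have hF := intervalIntegral.continuous_primitive hf 0
  have hG := intervalIntegral.continuous_primitive hg 0
  have heq : (fun x : ℝ => ∫ x' in (-x)..(l - x), singleLayerIntegrand s k l i j x x')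
      = fun x : ℝ => (basis l i x : ℂ) * ((basis l j x : ℂ)
          * ((∫ t in (0 : ℝ)..(l - x), f t) - ∫ t in (0 : ℝ)..(-x), f t)
        + (basisSlope l j : ℂ)
          * ((∫ t in (0 : ℝ)..(l - x), g t) - ∫ t in (0 : ℝ)..(-x), g t)) := by
    funext x
    rw [intervalIntegral.integral_interval_sub_left (hf _ _) (hf _ _),
      intervalIntegral.integral_interval_sub_left (hg _ _) (hg _ _),
      ← intervalIntegral.integral_const_mul, ← intervalIntegral.integral_const_mul,
      ← intervalIntegral.integral_add ((hf _ _).const_mul _) ((hg _ _).const_mul _),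
      ← intervalIntegral.integral_const_mul]
    refine intervalIntegral.integral_congr fun t _ => ?_
    simp only [singleLayerIntegrand, basis_add, f, g]
    push_cast; ring
  rw [heq]
  have h1 := continuous_basis l i
  have h2 := continuous_basis l j
  have h3 : Continuous fun x : ℝ => l - x := by fun_prop
  have e1 := hF.comp h3
  have e2 := hF.comp continuous_neg
  have e3 := hG.comp h3
  have e4 := hG.comp continuous_neg
  exact (Complex.continuous_ofReal.comp h1).mul
    (((Complex.continuous_ofReal.comp h2).mul (e1.sub e2)).add (continuous_const.mul (e3.sub e4)))

/-- In `Fin 2`, `1 - i` is the other index. -/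
theorem basis_rev (l : ℝ) (hl : 0 < l) (i : Fin 2) (x : ℝ) :
    basis l i (l - x) = basis l (1 - i) x := by
  have := hl.ne'
  fin_cases i <;> simp [basis] <;> field_simp
  ring

/-- Reflection of the element exchanges the basis functions. -/
theorem singleLayer_rev (s : ℤˣ) (k : ℝ) {l : ℝ} (hl : 0 < l) (i j : Fin 2) :
    singleLayer s k l i j = singleLayer s k l (1 - i) (1 - j) := by
  have h1 := intervalIntegral.integral_comp_sub_left (a := 0) (b := l)
    (fun x : ℝ => ∫ x' in (-x)..(l - x), singleLayerIntegrand s k l i j x x') l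
  rw [singleLayer, singleLayer]
  rw [sub_self, sub_zero] at h1
  rw [← h1]
  congr 1
  refine intervalIntegral.integral_congr fun x _ => ?_
  have h2 := intervalIntegral.integral_comp_neg (a := -x) (b := l - x)
    (fun x' : ℝ => singleLayerIntegrand s k l i j (l - x) x')
  rw [show l - (l - x) = - -x by ring, ← h2]
  refine intervalIntegral.integral_congr fun x' _ => ?_
  simp only [singleLayerIntegrand, abs_neg]
  rw [show -x' + (l - x) = l - (x' + x) by ring, basis_rev l hl, basis_rev l hl]

/-! ### The kernel on a straight line -/

theorem norm_smul_add_smul {E : Type*} [NormedAddCommGroup E] [InnerProductSpace ℝ E] {τ n : E}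
    (hτ : ‖τ‖ = 1) (hn : ‖n‖ = 1) (h : inner ℝ τ n = 0) (a b : ℝ) :
    ‖a • τ + b • n‖ = √(a ^ 2 + b ^ 2) := by
  have h1 : ‖a • τ + b • n‖ ^ 2 = a ^ 2 + b ^ 2 := by
    rw [norm_add_sq_real, inner_smul_left, inner_smul_right, h, norm_smul, norm_smul, hτ, hn]
    simp
  rw [← h1, Real.sqrt_sq (norm_nonneg _)]

theorem hasDerivAt_hankel_zero_sqrt (s : ℤˣ) {k d : ℝ} (hk : 0 < k) (hd : d ≠ 0) (u : ℝ) :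
    HasDerivAt (fun u : ℝ => hankel s 0 ((k * √(d ^ 2 + u ^ 2) : ℝ) : ℂ))
      (-hankel s 1 ((k * √(d ^ 2 + u ^ 2) : ℝ) : ℂ) * ((k * (u / √(d ^ 2 + u ^ 2)) : ℝ) : ℂ)) u := by
  have hpos : 0 < d ^ 2 + u ^ 2 := by positivity
  have h1 : HasDerivAt (fun u : ℝ => k * √(d ^ 2 + u ^ 2)) (k * (u / √(d ^ 2 + u ^ 2))) u := by
    have := (((hasDerivAt_pow 2 u).const_add (d ^ 2)).sqrt hpos.ne').const_mul k
    refine this.congr_deriv ?_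
    have : √(d ^ 2 + u ^ 2) ≠ 0 := (Real.sqrt_pos.mpr hpos).ne'
    field_simp
    simp
  exact (hasDerivAt_hankel_zero s (ofReal_mem_slitPlane_of_pos
    (mul_pos hk (Real.sqrt_pos.mpr hpos)))).comp u h1.ofReal_comp

/-- Along the normals the distance is √(d² + (t - t')²). The first derivative, taken at t' = 0, has
a factor t, so at t = 0 the second derivative sees only the slope k/|d| of k t/√(d² + t²). -/
theorem hypersingularKernel_eq (s : ℤˣ) {k : ℝ} (hk : 0 < k) (A τ n : EuclideanSpace ℝ (Fin 2))
    (hτ : ‖τ‖ = 1) (hn : ‖n‖ = 1) (h : inner ℝ τ n = 0) (x : ℝ) {d : ℝ} (hd : d ≠ 0) :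
    hypersingularKernel s k n n (A + x • τ) (A + (x + d) • τ)
      = Complex.I * k / 4 * (hankel s 1 ((k * |d| : ℝ) : ℂ) / ((|d| : ℝ) : ℂ)) := by
  have hg : ∀ t t' : ℝ, green s k (A + x • τ + t • n) (A + (x + d) • τ + t' • n)
      = Complex.I / 4 * hankel s 0 ((k * √(d ^ 2 + (t - t') ^ 2) : ℝ) : ℂ) := by
    intro t t'
    rw [green, show A + x • τ + t • n - (A + (x + d) • τ + t' • n) = (-d) • τ + (t - t') • n by
      module, norm_smul_add_smul hτ hn h, neg_sq]
  set H : ℝ → ℂ := fun u => hankel s 1 ((k * √(d ^ 2 + u ^ 2) : ℝ) : ℂ)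
  have hin : ∀ t : ℝ, deriv (fun t' : ℝ => green s k (A + x • τ + t • n)
      (A + (x + d) • τ + t' • n)) 0
      = Complex.I / 4 * (H t * ((k * (t / √(d ^ 2 + t ^ 2)) : ℝ) : ℂ)) := by
    intro t
    simp only [hg]
    have h0 := hasDerivAt_hankel_zero_sqrt s hk hd (t - 0)
    have h1 := (h0.scomp (0 : ℝ) ((hasDerivAt_id (0 : ℝ)).const_sub t)).const_mul (Complex.I / 4)
    rw [sub_zero] at h1
    refine h1.deriv.trans ?_
    simp only [H, neg_smul, one_smul]
    ring
  have hHd : HasDerivAt (fun t : ℝ => Complex.I / 4 * (H t * ((k * (t / √(d ^ 2 + t ^ 2)) : ℝ) : ℂ)))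
      (Complex.I / 4 * (H 0 * ((k * (1 / |d|) : ℝ) : ℂ))) 0 := by
    have hpos : 0 < d ^ 2 + (0 : ℝ) ^ 2 := by positivity
    have hs : HasDerivAt (fun u : ℝ => √(d ^ 2 + u ^ 2)) 0 0 := by
      refine (((hasDerivAt_pow 2 (0 : ℝ)).const_add (d ^ 2)).sqrt hpos.ne').congr_deriv ?_
      simp
    have hsd : √(d ^ 2 + (0 : ℝ) ^ 2) = |d| := by simp [Real.sqrt_sq_eq_abs]
    have habs : |d| ≠ 0 := abs_ne_zero.mpr hd
    have hq : HasDerivAt (fun u : ℝ => k * (u / √(d ^ 2 + u ^ 2))) (k * (1 / |d|)) 0 := by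
      refine (((hasDerivAt_id (0 : ℝ)).div hs (by rw [hsd]; exact habs)).const_mul k).congr_deriv ?_
      rw [hsd]
      simp only [id]
      field_simp
      ring
    -- Only differentiability matters here, since this derivative is multiplied by 0 in the product
    -- rule.
    have hH : HasDerivAt H (hankelDot s ((k * √(d ^ 2 + (0 : ℝ) ^ 2) : ℝ) : ℂ)
        * ((k * 0 : ℝ) : ℂ)) 0 :=
      HasDerivAt.comp (h₂ := hankel s 1) (h := fun u : ℝ => ((k * √(d ^ 2 + u ^ 2) : ℝ) : ℂ)) 0
        (hasDerivAt_hankel_one' s (ofReal_mem_slitPlane_of_pos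
          (mul_pos hk (Real.sqrt_pos.mpr hpos)))) (hs.const_mul k).ofReal_comp
    refine ((hH.mul hq.ofReal_comp).const_mul (Complex.I / 4)).congr_deriv ?_
    simp
  rw [hypersingularKernel, funext hin, hHd.deriv]
  simp only [H]
  rw [show √(d ^ 2 + (0 : ℝ) ^ 2) = |d| by simp [Real.sqrt_sq_eq_abs]]
  push_cast
  ring

theorem hankel_one_div_eq (s : ℤˣ) {k d : ℝ} (hk : 0 < k) (hd : d ≠ 0) :
    Complex.I * k / 4 * (hankel s 1 ((k * |d| : ℝ) : ℂ) / ((|d| : ℝ) : ℂ))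
      = Complex.I * (k : ℂ) ^ 2 / 4 * (hankel s 0 ((k * |d| : ℝ) : ℂ)
          - hankelDot s ((k * |d| : ℝ) : ℂ)) := by
  have habs : 0 < |d| := abs_pos.mpr hd
  rw [hankelDot_eq s (ofReal_mem_slitPlane_of_pos (mul_pos hk habs))]
  have h1 : (k : ℂ) ≠ 0 := by exact_mod_cast hk.ne'
  have h2 : ((|d| : ℝ) : ℂ) ≠ 0 := by exact_mod_cast habs.ne'
  push_cast
  field_simp
  ring

/-! ### The regularized inner integral in closed form -/

/-- `∫_{-x}^{y} H_1'(k|x'|) p_2(x'+x) dx'`, regularized, where `y = l - x`. -/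
def regInner (s : ℤˣ) (k l x y : ℝ) : ℂ :=
  hankel s 1 ((k * y : ℝ) : ℂ) / k
    + (hankel s 0 ((k * y : ℝ) : ℂ) - hankel s 0 ((k * x : ℝ) : ℂ)) / ((k : ℂ) ^ 2 * l)

/-- In Υ_γ the two terms x H_1(kx) cancel, and the coefficients of H_1(k(l - x)) add up through x +
(l - x) = l. The other basis function gives the mirror image, hence the exchanged arguments. -/
theorem upsInner_eq (s : ℤˣ) {k l x : ℝ} (hk : 0 < k) (hx : x ∈ Set.Ioo 0 l) (i j : Fin 2) :
    upsInner s k l i j x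
      = (basis l i x : ℂ) * ![regInner s k l (l - x) x, regInner s k l x (l - x)] j := by
  have h1 : 0 < k * x := mul_pos hk hx.1
  have h2 : 0 < k * (l - x) := mul_pos hk (sub_pos.mpr hx.2)
  have hk' : (k : ℂ) ≠ 0 := by exact_mod_cast hk.ne'
  have hl' : (l : ℂ) ≠ 0 := by exact_mod_cast (hx.1.trans hx.2).ne'
  rw [upsInner, upsZero_eq s h1, upsZero_eq s h2, upsOneDiff_eq s h1 h2]
  fin_cases i <;> fin_cases j <;>
    simp [-mul_eq_mul_left_iff, basis, regInner, upsInnerOf, upsAlpha, upsBeta, upsGamma,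
      upsDelta] <;>
    field_simp <;> ring

theorem continuousOn_comp_mul {f : ℂ → ℂ} (hf : ContinuousOn f Complex.slitPlane) {k : ℝ}
    (hk : 0 < k) {φ : ℝ → ℝ} (hφ : Continuous φ) {S : Set ℝ} (hS : ∀ x ∈ S, 0 < φ x) :
    ContinuousOn (fun x => f ((k * φ x : ℝ) : ℂ)) S :=
  (continuousOn_comp_ofReal hf).comp (by fun_prop) fun x hx => mul_pos hk (hS x hx)

theorem continuousOn_regInner (s : ℤˣ) {k : ℝ} (hk : 0 < k) (l : ℝ) {φ ψ : ℝ → ℝ}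
    (hφ : Continuous φ) (hψ : Continuous ψ) {S : Set ℝ} (hS : ∀ x ∈ S, 0 < φ x)
    (hS' : ∀ x ∈ S, 0 < ψ x) :
    ContinuousOn (fun x => regInner s k l (φ x) (ψ x)) S :=
  ((continuousOn_comp_mul (continuousOn_hankel_one s) hk hψ hS').div_const _).add
    (((continuousOn_comp_mul (continuousOn_hankel_zero s) hk hψ hS').sub
      (continuousOn_comp_mul (continuousOn_hankel_zero s) hk hφ hS)).div_const _)

theorem continuousOn_upsInner (s : ℤˣ) {k l : ℝ} (hk : 0 < k) (i j : Fin 2) :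
    ContinuousOn (upsInner s k l i j) (Set.Ioo 0 l) := by
  refine ContinuousOn.congr ?_ fun x hx => upsInner_eq s hk hx i j
  refine (Complex.continuous_ofReal.comp (continuous_basis l i)).continuousOn.mul ?_
  have hp : ∀ x ∈ Set.Ioo 0 l, 0 < x := fun x hx => hx.1
  have hq : ∀ x ∈ Set.Ioo 0 l, 0 < l - x := fun x hx => sub_pos.mpr hx.2
  have hc : Continuous fun x : ℝ => l - x := by fun_prop
  fin_cases j
  · exact continuousOn_regInner s hk l hc continuous_id hq hp
  · exact continuousOn_regInner s hk l continuous_id hc hp hq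

theorem uIcc_subset_Ioo {l ε : ℝ} (hε : 0 < ε) (hε' : ε < l / 2) :
    Set.uIcc ε (l - ε) ⊆ Set.Ioo 0 l := by
  rw [Set.uIcc_of_le (by linarith)]
  exact fun x hx => ⟨hε.trans_le hx.1, by linarith [hx.2]⟩

theorem intervalIntegrable_upsInner (s : ℤˣ) {k l : ℝ} (hk : 0 < k) (i j : Fin 2) {ε : ℝ}
    (hε : 0 < ε) (hε' : ε < l / 2) :
    IntervalIntegrable (upsInner s k l i j) volume ε (l - ε) :=
  ((continuousOn_upsInner s hk i j).mono (uIcc_subset_Ioo hε hε')).intervalIntegrable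

theorem upsilon_rev (s : ℤˣ) {k l : ℝ} (hk : 0 < k) (hl : 0 < l) (i j : Fin 2) {ε : ℝ}
    (hε : 0 < ε) (hε' : ε < l / 2) :
    upsilon s k l i j ε = upsilon s k l (1 - i) (1 - j) ε := by
  have h1 := intervalIntegral.integral_comp_sub_left (a := ε) (b := l - ε)
    (upsInner s k l i j) l
  rw [sub_sub_cancel] at h1
  rw [upsilon, upsilon, singleLayer_rev s k hl i j, ← h1]
  congr 2
  refine intervalIntegral.integral_congr fun x hx => ?_
  have hx := uIcc_subset_Ioo hε hε' hx
  have hx' : l - x ∈ Set.Ioo 0 l := ⟨sub_pos.mpr hx.2, by linarith [hx.1]⟩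
  rw [upsInner_eq s hk hx, upsInner_eq s hk hx', basis_rev l hl, sub_sub_cancel]
  fin_cases j <;> simp

/-! ### The outer integral in closed form -/

theorem hasDerivAt_hankel_zero_mul (s : ℤˣ) {k x : ℝ} (hk : 0 < k) (hx : 0 < x) :
    HasDerivAt (fun x : ℝ => hankel s 0 ((k * x : ℝ) : ℂ)) (-(k * hankel s 1 ((k * x : ℝ) : ℂ))) x := by
  have h := (hasDerivAt_hankel_zero s (ofReal_mem_slitPlane_of_pos (mul_pos hk hx))).comp x
    ((hasDerivAt_id x).const_mul k).ofReal_comp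
  refine h.congr_deriv ?_
  push_cast; ring

theorem hasDerivAt_mul_hankel_one_mul (s : ℤˣ) {k x : ℝ} (hk : 0 < k) (hx : 0 < x) :
    HasDerivAt (fun x : ℝ => (x : ℂ) * hankel s 1 ((k * x : ℝ) : ℂ))
      (k * x * hankel s 0 ((k * x : ℝ) : ℂ)) x := by
  have hk' : (k : ℂ) ≠ 0 := by exact_mod_cast hk.ne'
  have h := ((hasDerivAt_mul_hankel_one s (ofReal_mem_slitPlane_of_pos (mul_pos hk hx))).comp x
    ((hasDerivAt_id x).const_mul k).ofReal_comp).const_mul (1 / (k : ℂ))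
  have h' := h.congr_of_eventuallyEq
    (f₁ := fun x : ℝ => (x : ℂ) * hankel s 1 ((k * x : ℝ) : ℂ)) (.of_forall fun y => by
      simp only [Function.comp_apply, id]
      push_cast
      field_simp)
  refine h'.congr_deriv ?_
  push_cast
  field_simp

/-- With y = l - x, differentiating x H_0(ky) yields the term x H_1(ky) and a surplus H_0(ky). The
derivatives of y H_1(ky) and x H_1(kx) remove that surplus and supply the terms x H_0(ky) and x
H_0(kx). -/
theorem integral_upsInner_one_one (s : ℤˣ) {k l ε : ℝ} (hk : 0 < k) (hε : 0 < ε)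
    (hε' : ε < l / 2) :
    ∫ x in ε..(l - ε), upsInner s k l 1 1 x
      = (((l - ε : ℝ) : ℂ) * hankel s 0 ((k * ε : ℝ) : ℂ)
          - ε * hankel s 0 ((k * (l - ε) : ℝ) : ℂ)) / (l * (k : ℂ) ^ 2)
        - 2 / ((k : ℂ) ^ 3 * (l : ℂ) ^ 2) *
          (((l - ε : ℝ) : ℂ) * hankel s 1 ((k * (l - ε) : ℝ) : ℂ)
            - ε * hankel s 1 ((k * ε : ℝ) : ℂ)) := by
  have hk' : (k : ℂ) ≠ 0 := by exact_mod_cast hk.ne'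
  have hl' : (l : ℂ) ≠ 0 := by exact_mod_cast (by linarith : 0 < l).ne'
  have h := intervalIntegral.integral_eq_sub_of_hasDerivAt
    (f := fun x : ℝ => (x : ℂ) * hankel s 0 ((k * (l - x) : ℝ) : ℂ) / (l * (k : ℂ) ^ 2)
      + 1 / ((k : ℂ) ^ 3 * (l : ℂ) ^ 2) *
        (((l - x : ℝ) : ℂ) * hankel s 1 ((k * (l - x) : ℝ) : ℂ)
          - (x : ℂ) * hankel s 1 ((k * x : ℝ) : ℂ))) (fun x hx => ?_)
    (intervalIntegrable_upsInner s hk 1 1 hε hε')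
  · rw [h, sub_sub_cancel]
    field_simp
    ring
  · have hx := uIcc_subset_Ioo hε hε' hx
    have hx' : 0 < l - x := sub_pos.mpr hx.2
    have hr : HasDerivAt (fun x : ℝ => l - x) (-1) x := (hasDerivAt_id x).const_sub l
    have d1 := (hasDerivAt_hankel_zero_mul s hk hx').scomp x hr
    have d2 := (hasDerivAt_mul_hankel_one_mul s hk hx').scomp x hr
    have d3 := hasDerivAt_mul_hankel_one_mul s hk hx.1
    have d4 : HasDerivAt (fun x : ℝ => (x : ℂ)) 1 x := (hasDerivAt_id x).ofReal_comp
    refine (((d4.mul d1).div_const (l * (k : ℂ) ^ 2)).add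
      ((d2.sub d3).const_mul (1 / ((k : ℂ) ^ 3 * (l : ℂ) ^ 2)))).congr_deriv ?_
    rw [upsInner_eq s hk hx]
    simp [basis, regInner]
    field_simp
    ring

/-- Since p_1 + p_2 = 1, the two integrands add up to `regInner`. Its H_0 difference is odd under x
→ l - x and integrates to zero; its H_1 term is a derivative of H_0. -/
theorem integral_upsInner_zero_one (s : ℤˣ) {k l ε : ℝ} (hk : 0 < k) (hε : 0 < ε)
    (hε' : ε < l / 2) :
    ∫ x in ε..(l - ε), upsInner s k l 0 1 x
      = (hankel s 0 ((k * ε : ℝ) : ℂ) - hankel s 0 ((k * (l - ε) : ℝ) : ℂ)) / (k : ℂ) ^ 2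
        - ∫ x in ε..(l - ε), upsInner s k l 1 1 x := by
  have hk' : (k : ℂ) ≠ 0 := by exact_mod_cast hk.ne'
  have hl' : (l : ℂ) ≠ 0 := by exact_mod_cast (by linarith : 0 < l).ne'
  rw [eq_sub_iff_add_eq, ← intervalIntegral.integral_add
    (intervalIntegrable_upsInner s hk 0 1 hε hε') (intervalIntegrable_upsInner s hk 1 1 hε hε')]
  have hsub := uIcc_subset_Ioo hε hε'
  have hc : Continuous fun x : ℝ => l - x := by fun_prop
  have hp : ∀ x ∈ Set.uIcc ε (l - ε), 0 < x := fun x hx => (hsub hx).1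
  have hq : ∀ x ∈ Set.uIcc ε (l - ε), 0 < l - x := fun x hx => sub_pos.mpr (hsub hx).2
  have i1 := (continuousOn_comp_mul (continuousOn_hankel_one s) hk hc hq).intervalIntegrable
    (μ := volume)
  have i2 := (continuousOn_comp_mul (continuousOn_hankel_zero s) hk hc hq).intervalIntegrable
    (μ := volume)
  have i3 := (continuousOn_comp_mul (continuousOn_hankel_zero s) hk continuous_id
    hp).intervalIntegrable (μ := volume)
  simp only [id] at i3
  have hrefl := intervalIntegral.integral_comp_sub_left (a := ε) (b := l - ε)
    (fun x : ℝ => hankel s 0 ((k * x : ℝ) : ℂ)) l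
  rw [sub_sub_cancel] at hrefl
  have hQ := intervalIntegral.integral_eq_sub_of_hasDerivAt
    (f := fun x : ℝ => hankel s 0 ((k * (l - x) : ℝ) : ℂ))
    (f' := fun x : ℝ => k * hankel s 1 ((k * (l - x) : ℝ) : ℂ)) (fun x hx => by
      have hr : HasDerivAt (fun x : ℝ => l - x) (-1) x := (hasDerivAt_id x).const_sub l
      refine ((hasDerivAt_hankel_zero_mul s hk (hq x hx)).scomp x hr).congr_deriv ?_
      simp) (i1.const_mul (k : ℂ))
  rw [intervalIntegral.integral_const_mul, sub_sub_cancel] at hQ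
  have heq : ∫ x in ε..(l - ε), (upsInner s k l 0 1 x + upsInner s k l 1 1 x)
      = ∫ x in ε..(l - ε), (hankel s 1 ((k * (l - x) : ℝ) : ℂ) / k
        + (hankel s 0 ((k * (l - x) : ℝ) : ℂ) - hankel s 0 ((k * x : ℝ) : ℂ))
          / ((k : ℂ) ^ 2 * l)) := by
    refine intervalIntegral.integral_congr fun x hx => ?_
    simp only [upsInner_eq s hk (hsub hx)]
    simp [basis, regInner]
    ring
  rw [heq, intervalIntegral.integral_add (i1.div_const _) ((i2.sub i3).div_const _),
    intervalIntegral.integral_div, intervalIntegral.integral_div,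
    intervalIntegral.integral_sub i2 i3, hrefl]
  simp only [sub_self, zero_div, add_zero]
  rw [← hQ]
  field_simp

/-! ### Behaviour at the origin -/

theorem tendsto_mul_log_mul {c : ℝ} (hc : 0 < c) :
    Tendsto (fun ε : ℝ => (ε : ℂ) * ((Real.log (c * ε) : ℝ) : ℂ)) (𝓝[>] 0) (𝓝 0) := by
  have h : Continuous fun ε : ℝ => ((c⁻¹ * (c * ε * Real.log (c * ε)) : ℝ) : ℂ) :=
    Complex.continuous_ofReal.comp
      (continuous_const.mul (Real.continuous_mul_log.comp (continuous_const.mul continuous_id)))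
  have h0 := (h.tendsto 0).mono_left (nhdsWithin_le_nhds (s := Set.Ioi 0))
  simp only [mul_zero, Real.log_zero, Complex.ofReal_zero] at h0
  refine h0.congr fun ε => ?_
  rw [← Complex.ofReal_mul]
  congr 1
  field_simp

theorem log_half_mul {k ε : ℝ} (hk : 0 < k) (hε : 0 < ε) :
    Complex.log (((k * ε : ℝ) : ℂ) / 2) = ((Real.log (k / 2 * ε) : ℝ) : ℂ) := by
  rw [Complex.ofReal_log (by positivity)]
  congr 1
  push_cast; ring

theorem tendsto_comp_mul_zero {f : ℂ → ℂ} (hf : Continuous f) (k : ℝ) :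
    Tendsto (fun ε : ℝ => f ((k * ε : ℝ) : ℂ)) (𝓝[>] 0) (𝓝 (f 0)) := by
  have h : Continuous fun ε : ℝ => f ((k * ε : ℝ) : ℂ) := by fun_prop
  simpa using (h.tendsto 0).mono_left (nhdsWithin_le_nhds (s := Set.Ioi 0))

theorem tendsto_ofReal_zero : Tendsto (fun ε : ℝ => (ε : ℂ)) (𝓝[>] 0) (𝓝 0) := by
  simpa using (Complex.continuous_ofReal.tendsto 0).mono_left
    (nhdsWithin_le_nhds (s := Set.Ioi 0))

/-- Only the pole -2/(πz) of Y_1 survives the factor ε. -/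
theorem tendsto_mul_hankel_one (s : ℤˣ) {k : ℝ} (hk : 0 < k) :
    Tendsto (fun ε : ℝ => (ε : ℂ) * hankel s 1 ((k * ε : ℝ) : ℂ)) (𝓝[>] 0)
      (𝓝 (-(2 * sgn s * Complex.I / (Real.pi * k)))) := by
  have hk' : (k : ℂ) ≠ 0 := by exact_mod_cast hk.ne'
  have hpi : (Real.pi : ℂ) ≠ 0 := by exact_mod_cast Real.pi_ne_zero
  have hJ := tendsto_comp_mul_zero (continuous_besselJ 1) k
  have hS := tendsto_comp_mul_zero (continuous_besselS 1) k
  have hL := tendsto_mul_log_mul (half_pos hk)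
  have h := (tendsto_ofReal_zero.mul hJ).add ((((hL.mul hJ).const_mul (2 / (Real.pi : ℂ))).sub_const
    (2 / ((Real.pi : ℂ) * k))).sub ((tendsto_ofReal_zero.mul hS).const_mul (1 / (Real.pi : ℂ)))
      |>.const_mul (sgn s * Complex.I))
  rw [show 0 * besselJ 1 0 + sgn s * Complex.I * (2 / (Real.pi : ℂ) * (0 * besselJ 1 0)
      - 2 / ((Real.pi : ℂ) * k) - 1 / (Real.pi : ℂ) * (0 * besselS 1 0))
      = -(2 * sgn s * Complex.I / (Real.pi * k)) by ring] at h
  refine h.congr' ?_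
  filter_upwards [self_mem_nhdsWithin] with ε hε
  have hε : 0 < ε := hε
  have hε' : (ε : ℂ) ≠ 0 := by exact_mod_cast hε.ne'
  simp only [hankel, besselY_one_eq, log_half_mul hk hε]
  push_cast
  field_simp

/-- Writing J_0 = 1 + O(ε²) isolates the bare logarithm, since ε² log ε → 0; γ comes from the value
-2γ of the entire part of Y_0 at the origin. -/
theorem tendsto_hankel_zero_sub_log (s : ℤˣ) {k : ℝ} (hk : 0 < k) :
    Tendsto (fun ε : ℝ => hankel s 0 ((k * ε : ℝ) : ℂ)
        - sgn s * Complex.I * (2 / (Real.pi : ℂ)) * ((Real.log ε : ℝ) : ℂ)) (𝓝[>] 0)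
      (𝓝 (1 + sgn s * Complex.I * (2 / (Real.pi : ℂ)) *
        (((Real.eulerMascheroniConstant : ℝ) : ℂ) + ((Real.log (k / 2) : ℝ) : ℂ)))) := by
  have hpi : (Real.pi : ℂ) ≠ 0 := by exact_mod_cast Real.pi_ne_zero
  have hJ := tendsto_comp_mul_zero (continuous_besselJ 0) k
  have hS := tendsto_comp_mul_zero (continuous_besselS 0) k
  have hB := tendsto_comp_mul_zero ((entireCoeff_coeffJ 0).succ.continuous_bseries 0) k
  have hL := tendsto_mul_log_mul (half_pos hk)
  have hJ0 : besselJ 0 0 = 1 := by rw [besselJ_zero_eq]; simp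
  have hS0 : besselS 0 0 = -2 * ((Real.eulerMascheroniConstant : ℝ) : ℂ) := by
    rw [besselS, (entireCoeff_coeffS 0).bseries_zero_eq]
    simp [coeffS, coeffJ, digammaSucc]
    ring
  have h := hJ.add (((((hL.mul (tendsto_ofReal_zero.mul hB)).const_mul
    (2 / (Real.pi : ℂ) * (k : ℂ) ^ 2 / 4)).add_const
      (2 / (Real.pi : ℂ) * ((Real.log (k / 2) : ℝ) : ℂ))).sub (hS.const_mul (1 / (Real.pi : ℂ)))
      ).const_mul (sgn s * Complex.I))
  rw [hJ0, hS0] at h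
  refine (h.congr' ?_).trans (le_of_eq ?_)
  · filter_upwards [self_mem_nhdsWithin] with ε hε
    have hε : 0 < ε := hε
    have hlog : ((Real.log (k / 2 * ε) : ℝ) : ℂ)
        = ((Real.log (k / 2) : ℝ) : ℂ) + ((Real.log ε : ℝ) : ℂ) := by
      rw [Real.log_mul (by positivity) hε.ne', Complex.ofReal_add]
    rw [hankel, besselY_zero_eq, log_half_mul hk hε]
    have hJ' : besselJ 0 ((k * ε : ℝ) : ℂ) - 1 = ((k : ℂ) * ε / 2) ^ 2 *
        bseries (fun m => coeffJ 0 (m + 1)) 0 ((k * ε : ℝ) : ℂ) := by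
      rw [besselJ_zero_eq]; push_cast; ring
    linear_combination (-(sgn s * Complex.I * (2 / (Real.pi : ℂ))
      * ((Real.log (k / 2 * ε) : ℝ) : ℂ))) * hJ'
      - sgn s * Complex.I * (2 / (Real.pi : ℂ)) * hlog
  · congr 1
    ring

theorem tendsto_mul_hankel_zero (s : ℤˣ) {k : ℝ} (hk : 0 < k) :
    Tendsto (fun ε : ℝ => (ε : ℂ) * hankel s 0 ((k * ε : ℝ) : ℂ)) (𝓝[>] 0) (𝓝 0) := by
  have h := (tendsto_ofReal_zero.mul (tendsto_hankel_zero_sub_log s hk)).add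
    ((tendsto_mul_log_mul one_pos).const_mul (sgn s * Complex.I * (2 / (Real.pi : ℂ))))
  rw [zero_mul, mul_zero, add_zero] at h
  refine h.congr fun ε => ?_
  rw [one_mul]
  ring

theorem tendsto_comp_mul_sub {f : ℂ → ℂ} (hf : ContinuousOn f Complex.slitPlane) {k l : ℝ}
    (hk : 0 < k) (hl : 0 < l) :
    Tendsto (fun ε : ℝ => f ((k * (l - ε) : ℝ) : ℂ)) (𝓝[>] 0) (𝓝 (f ((k * l : ℝ) : ℂ))) := by
  have h : ContinuousOn (fun ε : ℝ => f ((k * (l - ε) : ℝ) : ℂ)) (Set.Iio l) :=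
    continuousOn_comp_mul hf hk (by fun_prop) fun x hx => sub_pos.mpr hx
  simpa using (h.continuousAt (Iio_mem_nhds hl)).tendsto.mono_left
    (nhdsWithin_le_nhds (s := Set.Ioi 0))

/-! ### The hypersingular integrals -/

theorem eventually_small {l : ℝ} (hl : 0 < l) : ∀ᶠ ε : ℝ in 𝓝[>] 0, 0 < ε ∧ ε < l / 2 :=
  Ioo_mem_nhdsGT (half_pos hl)

/-- The diagonal outer integral minus its singular part. -/
theorem tendsto_integral_upsInner_one_one (s : ℤˣ) {k l : ℝ} (hk : 0 < k) (hl : 0 < l) :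
    Tendsto (fun ε : ℝ => (∫ x in ε..(l - ε), upsInner s k l 1 1 x)
        - hankel s 0 ((k * ε : ℝ) : ℂ) / (k : ℂ) ^ 2) (𝓝[>] 0)
      (𝓝 (-(2 / ((k : ℂ) ^ 3 * l) * hankel s 1 ((k * l : ℝ) : ℂ))
        - 4 * sgn s * Complex.I / (Real.pi * (k : ℂ) ^ 4 * (l : ℂ) ^ 2))) := by
  have hk' : (k : ℂ) ≠ 0 := by exact_mod_cast hk.ne'
  have hl' : (l : ℂ) ≠ 0 := by exact_mod_cast hl.ne'
  have hpi : (Real.pi : ℂ) ≠ 0 := by exact_mod_cast Real.pi_ne_zero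
  have hlin : Tendsto (fun ε : ℝ => ((l - ε : ℝ) : ℂ)) (𝓝[>] 0) (𝓝 (l : ℂ)) := by
    simpa using tendsto_ofReal_zero.const_sub (l : ℂ)
  have t0 := tendsto_mul_hankel_zero s hk
  have t1 := tendsto_mul_hankel_one s hk
  have t2 := tendsto_ofReal_zero.mul (tendsto_comp_mul_sub (continuousOn_hankel_zero s) hk hl)
  have t3 := hlin.mul (tendsto_comp_mul_sub (continuousOn_hankel_one s) hk hl)
  -- H_0(kε) enters with factor (l - ε)/(l k²) = 1/k² - ε/(l k²). The first part is the subtracted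
  -- singular term, the second tends to zero against H_0(kε).
  have h := ((t0.add t2).const_mul (-(1 / (l * (k : ℂ) ^ 2)))).sub
    ((t3.sub t1).const_mul (2 / ((k : ℂ) ^ 3 * (l : ℂ) ^ 2)))
  refine (h.congr' ?_).trans (le_of_eq ?_)
  · filter_upwards [eventually_small hl] with ε hε
    rw [integral_upsInner_one_one s hk hε.1 hε.2]
    push_cast
    field_simp
    ring
  · congr 1
    field_simp
    ring

theorem tendsto_upsilon_diag (s : ℤˣ) {k l : ℝ} (hk : 0 < k) (hl : 0 < l) (i : Fin 2) :
    Tendsto (fun ε : ℝ => upsilon s k l i i ε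
        - ((k : ℂ) ^ 2 * singleLayer s k l 0 0
          - Complex.I / 4 * hankel s 0 ((k * ε : ℝ) : ℂ)
          + Complex.I / (2 * k * l) * hankel s 1 ((k * l : ℝ) : ℂ)
          - sgn s * (1 / (Real.pi * (k : ℂ) ^ 2 * (l : ℂ) ^ 2)))) (𝓝[>] 0) (𝓝 0) := by
  have hk' : (k : ℂ) ≠ 0 := by exact_mod_cast hk.ne'
  have hl' : (l : ℂ) ≠ 0 := by exact_mod_cast hl.ne'
  have hpi : (Real.pi : ℂ) ≠ 0 := by exact_mod_cast Real.pi_ne_zero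
  have hs : singleLayer s k l 1 1 = singleLayer s k l 0 0 := singleLayer_rev s k hl 1 1
  have h := ((tendsto_integral_upsInner_one_one s hk hl).const_mul
    (-(Complex.I * (k : ℂ) ^ 2 / 4))).sub_const
      (Complex.I / (2 * k * l) * hankel s 1 ((k * l : ℝ) : ℂ)
        - sgn s * (1 / (Real.pi * (k : ℂ) ^ 2 * (l : ℂ) ^ 2)))
  refine (h.congr' ?_).trans (le_of_eq ?_)
  · filter_upwards [eventually_small hl] with ε hε
    have hi : upsilon s k l i i ε = upsilon s k l 1 1 ε := by
      fin_cases i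
      · exact upsilon_rev s hk hl 0 0 hε.1 hε.2
      · rfl
    rw [hi, upsilon, hs]
    field_simp
    ring
  · congr 1
    field_simp
    ring_nf
    simp only [Complex.I_sq]
    ring

/-- The integral of U_12 is a difference in which H_0(kε)/k² occurs twice with opposite signs, so no
divergence remains. -/
theorem tendsto_upsilon_zero_one (s : ℤˣ) {k l : ℝ} (hk : 0 < k) (hl : 0 < l) :
    Tendsto (upsilon s k l 0 1) (𝓝[>] 0)
      (𝓝 ((k : ℂ) ^ 2 * singleLayer s k l 0 1
          + Complex.I / 4 * hankel s 0 ((k * l : ℝ) : ℂ)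
          - Complex.I / (2 * k * l) * hankel s 1 ((k * l : ℝ) : ℂ)
          + sgn s * (1 / (Real.pi * (k : ℂ) ^ 2 * (l : ℂ) ^ 2)))) := by
  have hk' : (k : ℂ) ≠ 0 := by exact_mod_cast hk.ne'
  have hl' : (l : ℂ) ≠ 0 := by exact_mod_cast hl.ne'
  have hpi : (Real.pi : ℂ) ≠ 0 := by exact_mod_cast Real.pi_ne_zero
  have h := (((tendsto_integral_upsInner_one_one s hk hl).add
    ((tendsto_comp_mul_sub (continuousOn_hankel_zero s) hk hl).div_const ((k : ℂ) ^ 2))).const_mul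
      (Complex.I * (k : ℂ) ^ 2 / 4)).const_add ((k : ℂ) ^ 2 * singleLayer s k l 0 1)
  refine (h.congr' ?_).trans (le_of_eq ?_)
  · filter_upwards [eventually_small hl] with ε hε
    rw [upsilon, integral_upsInner_zero_one s hk hε.1 hε.2]
    ring
  · congr 1
    field_simp
    ring_nf
    simp only [Complex.I_sq]
    ring

theorem tendsto_upsilon_offDiag (s : ℤˣ) {k l : ℝ} (hk : 0 < k) (hl : 0 < l) {i j : Fin 2}
    (hij : i ≠ j) :
    Tendsto (upsilon s k l i j) (𝓝[>] 0)
      (𝓝 ((k : ℂ) ^ 2 * singleLayer s k l 0 1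
          + Complex.I / 4 * hankel s 0 ((k * l : ℝ) : ℂ)
          - Complex.I / (2 * k * l) * hankel s 1 ((k * l : ℝ) : ℂ)
          + sgn s * (1 / (Real.pi * (k : ℂ) ^ 2 * (l : ℂ) ^ 2)))) := by
  refine (tendsto_upsilon_zero_one s hk hl).congr' ?_
  filter_upwards [eventually_small hl] with ε hε
  fin_cases i <;> fin_cases j
  · exact absurd rfl hij
  · rfl
  · exact upsilon_rev s hk hl 0 1 hε.1 hε.2
  · exact absurd rfl hij

/-- Insert the expansion of H_0(kε) at the origin: as i² = -1, the factor -i/4 turns its logarithm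
into ±(1/2π) log ε, and J_0(0) = 1 leaves -i/4. -/
theorem tendsto_upsilon_diag_sub_log (s : ℤˣ) {k l : ℝ} (hk : 0 < k) (hl : 0 < l) (i : Fin 2) :
    Tendsto (fun ε : ℝ => upsilon s k l i i ε
        - sgn s * (1 / (2 * Real.pi)) * ((Real.log ε : ℝ) : ℂ)) (𝓝[>] 0)
      (𝓝 ((k : ℂ) ^ 2 * singleLayer s k l 0 0
          + Complex.I / (2 * k * l) * hankel s 1 ((k * l : ℝ) : ℂ)
          - Complex.I / 4
          + sgn s * (1 / (2 * Real.pi)) *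
            (((Real.eulerMascheroniConstant : ℝ) : ℂ) + ((Real.log (k / 2) : ℝ) : ℂ)
              - 2 / ((k : ℂ) ^ 2 * (l : ℂ) ^ 2)))) := by
  have hk' : (k : ℂ) ≠ 0 := by exact_mod_cast hk.ne'
  have hl' : (l : ℂ) ≠ 0 := by exact_mod_cast hl.ne'
  have hpi : (Real.pi : ℂ) ≠ 0 := by exact_mod_cast Real.pi_ne_zero
  have h := ((tendsto_upsilon_diag s hk hl i).sub
    ((tendsto_hankel_zero_sub_log s hk).const_mul (Complex.I / 4))).add_const
      ((k : ℂ) ^ 2 * singleLayer s k l 0 0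
        + Complex.I / (2 * k * l) * hankel s 1 ((k * l : ℝ) : ℂ)
        - sgn s * (1 / (Real.pi * (k : ℂ) ^ 2 * (l : ℂ) ^ 2)))
  refine (h.congr fun ε => ?_).trans (le_of_eq ?_)
  · linear_combination (sgn s / (2 * (Real.pi : ℂ)) * ((Real.log ε : ℝ) : ℂ)) * Complex.I_sq
  · congr 1
    field_simp
    ring_nf
    simp only [Complex.I_sq]
    ring

end Helmholtz2D

end

theorem mainTheorem4 (s : ℤˣ) (k l : ℝ) (hk : 0 < k) (hl : 0 < l) :
    -- the hypersingular kernel on a straight element, and its form by the recurrences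
    (∀ A τ n : EuclideanSpace ℝ (Fin 2), ‖τ‖ = 1 → ‖n‖ = 1 → inner ℝ τ n = 0 →
      ∀ x x' : ℝ, x' ≠ 0 →
        Helmholtz2D.hypersingularKernel s k n n (A + x • τ) (A + (x + x') • τ)
            = Complex.I * k / 4 * (Helmholtz2D.hankel s 1 ((k * |x'| : ℝ) : ℂ) / ((|x'| : ℝ) : ℂ))
        ∧ Complex.I * k / 4 * (Helmholtz2D.hankel s 1 ((k * |x'| : ℝ) : ℂ) / ((|x'| : ℝ) : ℂ))
            = Complex.I * (k : ℂ) ^ 2 / 4 * (Helmholtz2D.hankel s 0 ((k * |x'| : ℝ) : ℂ)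
                - Helmholtz2D.hankelDot s ((k * |x'| : ℝ) : ℂ))) ∧
    -- the single layer integrals converge absolutely
    (∀ (i j : Fin 2) (x : ℝ), IntervalIntegrable
      (Helmholtz2D.singleLayerIntegrand s k l i j x) volume (-x) (l - x)) ∧
    (∀ i j : Fin 2, IntervalIntegrable
      (fun x : ℝ => ∫ x' in (-x)..(l - x), Helmholtz2D.singleLayerIntegrand s k l i j x x')
      volume 0 l) ∧
    -- the splitting of the inner integral, with a neighbourhood of the singularity removed
    (∀ (i j : Fin 2) (x η : ℝ), 0 < η → η < x → η < l - x →
      Helmholtz2D.cutInner s k l i j x η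
        = Helmholtz2D.upsInnerOf k l i j x
            (∫ t in (k * η)..(k * x), Helmholtz2D.hankelDot s (t : ℂ))
            (∫ t in (k * η)..(k * (l - x)), Helmholtz2D.hankelDot s (t : ℂ))
            (Helmholtz2D.upsOneDiffApprox s (k * x) (k * (l - x)) (k * η))) ∧
    -- the integrals and limits in the regularizations exist
    (∀ σ η : ℝ, 0 < σ → 0 < η →
      IntervalIntegrable (fun x : ℝ => Helmholtz2D.hankelDot s ((x : ℂ) - Complex.I * (η : ℂ)))
        volume 0 σ ∧
      IntervalIntegrable (fun x : ℝ => Helmholtz2D.hankelDot s ((x : ℂ) + Complex.I * (η : ℂ)))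
        volume 0 σ) ∧
    (∀ σ : ℝ, 0 < σ →
      Tendsto (Helmholtz2D.upsZeroApprox s σ) (𝓝[>] 0) (𝓝 (Helmholtz2D.upsZero s σ))) ∧
    (∀ a b : ℝ, 0 < a → 0 < b →
      IntervalIntegrable (fun x : ℝ => Helmholtz2D.hankelDot s (x : ℂ) * (x : ℂ)) volume a b) ∧
    (∀ a b : ℝ, 0 < a → 0 < b →
      Tendsto (Helmholtz2D.upsOneDiffApprox s a b) (𝓝[>] 0)
        (𝓝 (Helmholtz2D.upsOneDiff s a b))) ∧
    (∀ (i j : Fin 2) (ε : ℝ), 0 < ε → ε < l / 2 →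
      IntervalIntegrable (Helmholtz2D.upsInner s k l i j) volume ε (l - ε)) ∧
    -- the symmetries
    (∀ ε : ℝ, 0 < ε → ε < l / 2 →
      Helmholtz2D.upsilon s k l 0 0 ε = Helmholtz2D.upsilon s k l 1 1 ε ∧
      Helmholtz2D.upsilon s k l 0 1 ε = Helmholtz2D.upsilon s k l 1 0 ε) ∧
    -- the diagonal integrals, up to a term that vanishes with `ε`
    (∀ i : Fin 2, Tendsto (fun ε : ℝ => Helmholtz2D.upsilon s k l i i ε
        - ((k : ℂ) ^ 2 * Helmholtz2D.singleLayer s k l 0 0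
          - Complex.I / 4 * Helmholtz2D.hankel s 0 ((k * ε : ℝ) : ℂ)
          + Complex.I / (2 * k * l) * Helmholtz2D.hankel s 1 ((k * l : ℝ) : ℂ)
          - Helmholtz2D.sgn s * (1 / (Real.pi * (k : ℂ) ^ 2 * (l : ℂ) ^ 2))))
      (𝓝[>] 0) (𝓝 0)) ∧
    -- the off-diagonal integrals
    (∀ i j : Fin 2, i ≠ j → Tendsto (Helmholtz2D.upsilon s k l i j) (𝓝[>] 0)
      (𝓝 ((k : ℂ) ^ 2 * Helmholtz2D.singleLayer s k l 0 1
          + Complex.I / 4 * Helmholtz2D.hankel s 0 ((k * l : ℝ) : ℂ)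
          - Complex.I / (2 * k * l) * Helmholtz2D.hankel s 1 ((k * l : ℝ) : ℂ)
          + Helmholtz2D.sgn s * (1 / (Real.pi * (k : ℂ) ^ 2 * (l : ℂ) ^ 2))))) ∧
    -- the diagonal integrals after removal of the logarithmic divergence
    (∀ i : Fin 2, Tendsto (fun ε : ℝ => Helmholtz2D.upsilon s k l i i ε
        - Helmholtz2D.sgn s * (1 / (2 * Real.pi)) * ((Real.log ε : ℝ) : ℂ))
      (𝓝[>] 0)
      (𝓝 ((k : ℂ) ^ 2 * Helmholtz2D.singleLayer s k l 0 0
          + Complex.I / (2 * k * l) * Helmholtz2D.hankel s 1 ((k * l : ℝ) : ℂ)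
          - Complex.I / 4
          + Helmholtz2D.sgn s * (1 / (2 * Real.pi)) *
            (((Real.eulerMascheroniConstant : ℝ) : ℂ) + ((Real.log (k / 2) : ℝ) : ℂ)
              - 2 / ((k : ℂ) ^ 2 * (l : ℂ) ^ 2))))) := by
  refine ⟨fun A τ n hτ hn h x x' hx' => ⟨?_, ?_⟩, fun i j x => ?_, fun i j => ?_,
    fun i j x η hη hx hx' => ?_, fun σ η hσ hη => ⟨?_, ?_⟩, fun σ hσ => ?_, fun a b ha hb => ?_,
    fun a b ha hb => ?_, fun i j ε hε hε' => ?_, fun ε hε hε' => ⟨?_, ?_⟩, fun i => ?_,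
    fun i j hij => ?_, fun i => ?_⟩
  · exact Helmholtz2D.hypersingularKernel_eq s hk A τ n hτ hn h x hx'
  · exact Helmholtz2D.hankel_one_div_eq s hk hx'
  · exact Helmholtz2D.intervalIntegrable_singleLayerIntegrand s hk l i j x _ _
  · exact (Helmholtz2D.continuous_integral_singleLayerIntegrand s hk l i j).intervalIntegrable _ _
  · exact Helmholtz2D.cutInner_eq s hk hl i j hη hx hx'
  · simp only [sub_eq_add_neg]
    exact Helmholtz2D.intervalIntegrable_hankelDot_add s (by simpa using hη.ne') 0 σ
  · exact Helmholtz2D.intervalIntegrable_hankelDot_add s (by simpa using hη.ne') 0 σ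
  · exact (Helmholtz2D.upsZero_eq s hσ).symm ▸ Helmholtz2D.tendsto_upsZeroApprox s hσ
  · exact Helmholtz2D.intervalIntegrable_hankelDot_mul s ha hb
  · exact (Helmholtz2D.upsOneDiff_eq s ha hb).symm ▸ Helmholtz2D.tendsto_upsOneDiffApprox s ha hb
  · exact Helmholtz2D.intervalIntegrable_upsInner s hk i j hε hε'
  · exact Helmholtz2D.upsilon_rev s hk hl 0 0 hε hε'
  · exact Helmholtz2D.upsilon_rev s hk hl 0 1 hε hε'
  · exact Helmholtz2D.tendsto_upsilon_diag s hk hl i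
  · exact Helmholtz2D.tendsto_upsilon_offDiag s hk hl hij
  · exact Helmholtz2D.tendsto_upsilon_diag_sub_log s hk hl i
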